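/- **Setting.** Let $T>0$ and consider on $[0,T]$ the forward SDE $dx_t=h(t)x_t\,dt+g(t)\,dw_t$, $x_0\sim P_{\rm data}$, in $\mathbb R^d$, where $P_{\rm data}$ is a probability measure and $h,g$ are continuous on $(0,T]$. Its noise schedule $(\alpha_t,\sigma_t^2)$ consists of continuous functions $\alpha,\sigma$ on $[0,T]$, positive on $(0,T]$, with $\alpha_0=1$, $\sigma_0=0$ and, on $(0,T]$, $$h(t)=\frac{d\log\alpha_t}{dt},\qquad g^2(t)=\frac{d\sigma_t^2}{dt}-2\,\frac{d\log\alpha_t}{dt}\,\sigma_t^2 .$$ Let $P_t$ be the law of $\alpha_t x_0+\sigma_t z$ with $x_0\sim P_{\rm data}$ and $z\sim\mathcal N(0,I)$ independent, and for $t>0$ let $p_t$ be its (smooth) density. For $t_0\in(0,T]$ let $t\mapsto\varphi_t(x;t_0)$ be the trajectory through $x$ at time $t_0$ of the probability flow ODE (PF-ODE) $$\frac{dx_t}{dt}=h(t)x_t-\tfrac12 g^2(t)\nabla\log p_t(x_t),$$ i.e. the function that is continuous on $[0,T]$, solves the ODE on $(0,T]$ and equals $x$ at $t=t_0$ (when $P_{\rm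 data}$ is as below, it exists and is unique for $P_{t_0}$-almost every $x$). Let $\Delta>0$ and let $M\ge1$ be an integer with $T=M\Delta$; the training partition is $0,\Delta,2\Delta,\dots,M\Delta=T$. Let $\hat f:\mathbb R^d\times[0,T]\to\mathbb R^d$ be measurable in its first argument. For $N\ge1$, a sampling schedule $T=\tau_1>\tau_2>\dots>\tau_N>0$ of points of the training partition defines the $N$-step sampler $$\hat x_1\sim\mathcal N(0,\sigma_{\tau_1}^2I),\qquad \hat y_i=\hat f(\hat x_i,\tau_i),\qquad \hat x_{i+1}\mid\hat y_i\sim\mathcal N(\alpha_{\tau_{i+1}}\hat y_i,\sigma_{\tau_{i+1}}^2I),$$ with output $\hat y_N$, whose law is denoted $\hat P^{(N)}$. **Theorem.** Let $\varepsilon>0$ and $R>0$, and assume: 1. $\hat f(x,0)=x$ for all $x\in\mathbb R^d$; 2. $\hat f$ is $\varepsilon^2$-self-consistent along the PF-ODE on each step of the training partition: $$\mathbb E_{x\sim P_{i\Delta}}\big\|\hat f(x,i\Delta)-\hat f\big(\varphi_{(i+1)\Delta}(x;i\Delta),(i+1)\Delta\big)\big\|_2^2\le\varepsilon^2,\qquad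 1\le i\le M-1,$$ and, on the first step (where the pair of points on one trajectory is parametrized by its later point, because the initial value problem need not be well posed at time $0$), $$\mathbb E_{x\sim P_{\Delta}}\big\|\hat f(\varphi_0(x;\Delta),0)-\hat f(x,\Delta)\big\|_2^2\le\varepsilon^2;$$ 3. $\|x\|_2\le R$ for every $x\in\operatorname{supp}P_{\rm data}$, and $\|\hat f(x,t)\|_2\le R$ for all $(x,t)\in\mathbb R^d\times(0,T]$. Then for every sampling schedule as above $$W_2\big(\hat P^{(N)},P_{\rm data}\big)\le 2R\left(\frac{\alpha_{\tau_1}^2}{4\sigma_{\tau_1}^2}R^2+\sum_{j=2}^N\frac{\alpha_{\tau_j}^2}{4\sigma_{\tau_j}^2}\,\tau_{j-1}^2\,\frac{\varepsilon^2}{\Delta^2}\right)^{1/4}+\tau_N\,\frac{\varepsilon}{\Delta},$$ where $W_2$ is the 2-Wasserstein distance for the Euclidean norm. -/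

import Mathlib

open MeasureTheory ProbabilityTheory Set
open scoped ENNReal

noncomputable section

namespace ConsistencyModel

/-- The Euclidean space `ℝ^d` with the Euclidean norm. -/
abbrev Vec (d : ℕ) : Type := EuclideanSpace ℝ (Fin d)

/-- `h`, `g` are the coefficients of the linear SDE `dx = h(t) x dt + g(t) dw` on `[0, T]`, and
`α`, `σ` is its noise schedule: `h = d log α / dt` and `g² = dσ²/dt - 2 (d log α / dt) σ²` on
`(0, T]`, with the initial values `α(0) = 1`, `σ(0) = 0` (so that the time-zero marginal is the
data distribution) and with `α`, `σ` positive on `(0, T]`. The coefficients are continuous on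
`(0, T]`; they may be singular at time zero. -/
structure IsNoiseSchedule (T : ℝ) (h g α σ : ℝ → ℝ) : Prop where
  continuousOn_h : ContinuousOn h (Ioc 0 T)
  continuousOn_g : ContinuousOn g (Ioc 0 T)
  continuousOn_α : ContinuousOn α (Icc 0 T)
  continuousOn_σ : ContinuousOn σ (Icc 0 T)
  α_zero : α 0 = 1
  σ_zero : σ 0 = 0
  α_pos : ∀ t ∈ Ioc 0 T, 0 < α t
  σ_pos : ∀ t ∈ Ioc 0 T, 0 < σ t
  deriv_log_α : ∀ t ∈ Ioc 0 T, HasDerivWithinAt (fun s => Real.log (α s)) (h t) (Icc 0 T) t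
  deriv_sq_σ : ∀ t ∈ Ioc 0 T,
    HasDerivWithinAt (fun s => σ s ^ 2) (g t ^ 2 + 2 * h t * σ t ^ 2) (Icc 0 T) t

/-- The law of `a x + s z` where `x ∼ P` and `z ∼ N(0, I)` are independent, i.e. the marginal law
of `x'` when `x ∼ P` and `x' | x ∼ N(a x, s² I)`. -/
def diffuse {d : ℕ} (a s : ℝ) (P : Measure (Vec d)) : Measure (Vec d) :=
  (P.prod (stdGaussian (Vec d))).map (fun p => a • p.1 + s • p.2)

/-- The marginal law `P_t` of the forward process started from the data distribution. -/
def marginal {d : ℕ} (α σ : ℝ → ℝ) (Pdata : Measure (Vec d)) (t : ℝ) : Measure (Vec d) :=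
  diffuse (α t) (σ t) Pdata

/-- The probability density `p_t` of the marginal law `P_t` (for `σ(t) > 0`), in its continuous
version: the mixture over `y ∼ Pdata` of the densities of `N(α(t) y, σ(t)² I)`. -/
def marginalDensity {d : ℕ} (α σ : ℝ → ℝ) (Pdata : Measure (Vec d)) (t : ℝ) (x : Vec d) : ℝ :=
  ∫ y, (2 * Real.pi * σ t ^ 2) ^ (-(d : ℝ) / 2) *
    Real.exp (-‖x - α t • y‖ ^ 2 / (2 * σ t ^ 2)) ∂Pdata

/-- The score `∇ log p_t(x)`. -/
def score {d : ℕ} (α σ : ℝ → ℝ) (Pdata : Measure (Vec d)) (t : ℝ) (x : Vec d) : Vec d :=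
  gradient (fun z => Real.log (marginalDensity α σ Pdata t z)) x

/-- The right-hand side `h(t) x - (1/2) g(t)² ∇ log p_t(x)` of the probability flow ODE. -/
def pfVelocity {d : ℕ} (h g α σ : ℝ → ℝ) (Pdata : Measure (Vec d)) (t : ℝ) (x : Vec d) : Vec d :=
  h t • x - ((1 / 2) * g t ^ 2) • score α σ Pdata t x

/-- `y` is a trajectory on `[0, T]` of the ODE `dy/dt = v(t, y)` with `y(t₀) = x`. The equation is
required on `(0, T]` (at time zero the law need not have a density, so the score is not defined
there), and `y` is continuous on `[0, T]`, so that `y(0)` is the limit of `y(t)` as `t ↓ 0`. -/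
structure IsTrajectory {d : ℕ} (v : ℝ → Vec d → Vec d) (T t₀ : ℝ) (x : Vec d)
    (y : ℝ → Vec d) : Prop where
  initial : y t₀ = x
  continuousOn : ContinuousOn y (Icc 0 T)
  ode : ∀ t ∈ Ioc 0 T, HasDerivWithinAt y (v t (y t)) (Icc 0 T) t

open Classical in
/-- The trajectory `t ↦ φ_t(x; t₀)` of the ODE `dy/dt = v(t, y)` on `[0, T]` through the point `x`
at time `t₀` (the constant `x` if there is no such trajectory). It is used for `t₀ > 0` only. -/
def trajectory {d : ℕ} (v : ℝ → Vec d → Vec d) (T t₀ : ℝ) (x : Vec d) : ℝ → Vec d :=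
  if hy : ∃ y, IsTrajectory v T t₀ x y then hy.choose else fun _ => x

theorem isTrajectory_trajectory {d : ℕ} {v : ℝ → Vec d → Vec d} {T t₀ : ℝ} {x : Vec d}
    (hy : ∃ y, IsTrajectory v T t₀ x y) : IsTrajectory v T t₀ x (trajectory v T t₀ x) := by
  unfold trajectory
  rw [dif_pos hy]
  exact hy.choose_spec

/-- The self-consistency loss of `f` on the step from `i Δ` to `(i + 1) Δ` of the training
partition of `[0, T]`: the mean of `‖f(x_{iΔ}, iΔ) - f(x_{(i+1)Δ}, (i+1)Δ)‖²` over pairs of points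
on one trajectory of the probability flow ODE. For `i ≥ 1` the pair is `x`, `φ_{(i+1)Δ}(x; iΔ)`
with `x ∼ P_{iΔ}`. For `i = 0` it is `φ_0(x; Δ)`, `x` with `x ∼ P_Δ`: for a general data
distribution (e.g. one with atoms) the initial value problem is not well posed at time zero, while
`P_Δ`-almost every point lies on a unique trajectory; `φ_0(x; Δ)` is the origin of `x`, and has
law `Pdata`. -/
def consistencyLoss {d : ℕ} (h g α σ : ℝ → ℝ) (Pdata : Measure (Vec d)) (T Δ : ℝ)
    (f : Vec d → ℝ → Vec d) (i : ℕ) : ℝ≥0∞ :=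
  if i = 0 then
    ∫⁻ x, ‖f (trajectory (pfVelocity h g α σ Pdata) T Δ x 0) 0 - f x Δ‖ₑ ^ 2
      ∂(marginal α σ Pdata Δ)
  else
    ∫⁻ x, ‖f x (i * Δ) -
        f (trajectory (pfVelocity h g α σ Pdata) T (i * Δ) x ((i + 1) * Δ)) ((i + 1) * Δ)‖ₑ ^ 2
      ∂(marginal α σ Pdata (i * Δ))

/-- The law of the output after `n` steps of multistep consistency sampling with times
`τ 1, τ 2, …`. In step `j` one draws `x_j ∼ N(α(τ j) y_{j-1}, σ(τ j)² I)`, where `y_{j-1}` is the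
previous output, and outputs `y_j = f(x_j, τ j)`. With `y_0 = 0` the first step draws
`x_1 ∼ N(0, σ(τ 1)² I)`. -/
def outputLaw {d : ℕ} (α σ : ℝ → ℝ) (f : Vec d → ℝ → Vec d) (τ : ℕ → ℝ) : ℕ → Measure (Vec d)
  | 0 => Measure.dirac 0
  | n + 1 => (diffuse (α (τ (n + 1))) (σ (τ (n + 1))) (outputLaw α σ f τ n)).map
      (fun x => f x (τ (n + 1)))

/-- The `2`-Wasserstein distance for the Euclidean norm, with values in `[0, ∞]`. -/
def W2 {d : ℕ} (P Q : Measure (Vec d)) : ℝ≥0∞ :=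
  ⨅ γ ∈ {γ : Measure (Vec d × Vec d) | γ.map Prod.fst = P ∧ γ.map Prod.snd = Q},
    (∫⁻ p, ‖p.1 - p.2‖ₑ ^ 2 ∂γ) ^ (1 / 2 : ℝ)

end ConsistencyModel

end

set_option linter.unusedSectionVars false

noncomputable section

/-! In the variables `u = x / σ`, `r = α / σ`, Tweedie's formula turns the probability flow ODE into
`du/dr = m(r, u)`, where `m(r, u)` is the mean of `y ∼ P` given `r y + z = u`. Since `P` lives in a
ball, this field is bounded and Lipschitz in `u`, so it has a global flow, whatever the
singularities of `h` and `g` at time zero; time zero corresponds to `r = ∞`.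

The flow carries the law of `a y + z` to that of `b y + z` (`map_odeFlow_noisyLaw`): the derivative
in `r` of the mean of a test function transported along the flow is the mean of `Dψ(r y + z)(y -
m)`, which vanishes by the tower property. Rescaled by `1 / r`, almost every flow line converges as
`r → ∞`, because the derivative is `-r⁻²` times a conditional mean of `z` and so has finite total
expectation; the limit has law `P` (`ae_tendsto_flowOrigin`, `map_flowOrigin`). Hence the map `o`
sending a point of `P_t` to the origin of its trajectory pushes `P_t` to `P`. Telescoping
self-consistency along a trajectory down to time zero, where `f` is the identity, puts `f(·, kΔ)`
within `k ε` of `o` in `L²(P_{kΔ})` (`exists_denoiser`).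

For the sampler, compare `P_{τ_n}` with the law of its `n`-th input. Both arise by the same Gaussian
noising, one from `o` applied to `P_{τ_{n-1}}`, the other from `f` applied to the previous input.
The chain rule for relative entropy adds `α² / (2σ²)` times `‖f - o‖²` in `L²(P_{τ_{n-1}})` at each
step, and only expectations under the true marginals occur, which is where the error of `f` is
controlled (`klBound_diffuse_outputLaw`). With total entropy `2S`, Pinsker bounds the total
variation distance by `√S`. In a maximal coupling of the last inputs the two values of `f` differ by
at most `2R`, and only on mass `√S`, which costs `2R S^{1/4}` in `L²`; replacing `f` by `o` under
`P_{τ_N}` costs `τ_N ε / Δ` (`W2_map_le`). -/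

namespace ConsistencyModel

open Filter Topology
open scoped NNReal RealInnerProductSpace

/-! ### Global flows of bounded, locally-in-time Lipschitz vector fields. -/

section Flow

variable {E : Type*} [NormedAddCommGroup E] [NormedSpace ℝ E]

/-- A bounded time-dependent vector field whose Lipschitz constant in space grows at most linearly
in time. -/
structure IsBoundedField (v : ℝ → E → E) (L K : ℝ≥0) : Prop where
  norm_le : ∀ t x, ‖v t x‖ ≤ L
  lipschitz : ∀ t x y, ‖v t x - v t y‖ ≤ K * |t| * ‖x - y‖
  continuous : Continuous (Function.uncurry v)

namespace IsBoundedField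

variable {v : ℝ → E → E} {L K : ℝ≥0}

theorem lipschitzWith (hv : IsBoundedField v L K) {n : ℝ≥0} {t : ℝ} (ht : |t| ≤ n) :
    LipschitzWith (K * n) (v t) := by
  refine LipschitzWith.of_dist_le_mul fun x y => ?_
  rw [dist_eq_norm, dist_eq_norm]
  refine (hv.lipschitz t x y).trans ?_
  push_cast
  gcongr

theorem continuous_left (hv : IsBoundedField v L K) (x : E) : Continuous (fun t => v t x) :=
  hv.continuous.comp (by fun_prop : Continuous fun t : ℝ => (t, x))

theorem eqOn_of_hasDerivAt (hv : IsBoundedField v L K) {f g : ℝ → E} {t₀ : ℝ} {n : ℝ≥0}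
    (h0 : |t₀| < n) (hf : ∀ t ∈ Ioo (-n : ℝ) n, HasDerivAt f (v t (f t)) t)
    (hg : ∀ t ∈ Ioo (-n : ℝ) n, HasDerivAt g (v t (g t)) t) (heq : f t₀ = g t₀) :
    EqOn f g (Ioo (-n : ℝ) n) :=
  ODE_solution_unique_of_mem_Ioo (v := v) (s := fun _ => univ) (K := K * n)
    (fun _ ht => (hv.lipschitzWith (abs_lt.2 ht).le).lipschitzOnWith) (abs_lt.1 h0)
    (fun t ht => ⟨hf t ht, mem_univ (f t)⟩) (fun t ht => ⟨hg t ht, mem_univ _⟩) heq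

/-- Picard–Lindelöf works on the whole window at once: the speed is at most `L` everywhere, so a
ball of radius `L * 2n` cannot be left in time `2n`, and the interval need not shrink. -/
theorem exists_local_solution [CompleteSpace E] (hv : IsBoundedField v L K) (t₀ : ℝ) (x : E)
    {n : ℝ≥0} (hn : |t₀| < n) :
    ∃ u : ℝ → E, u t₀ = x ∧ ∀ t ∈ Ioo (-n : ℝ) n, HasDerivAt u (v t (u t)) t := by
  have hmem : t₀ ∈ Icc (-n : ℝ) n := abs_le.1 hn.le
  have hPL : IsPicardLindelof v (⟨t₀, hmem⟩ : Icc (-n : ℝ) n) x (L * (2 * n)) 0 L (K * n) := by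
    refine ⟨fun t ht => (hv.lipschitzWith (abs_le.2 ht)).lipschitzOnWith,
      fun y _ => (hv.continuous_left y).continuousOn, fun t _ y _ => hv.norm_le t y, ?_⟩
    push_cast
    rw [sub_zero]
    refine mul_le_mul_of_nonneg_left (max_le ?_ ?_) L.2 <;> linarith [hmem.1, hmem.2]
  obtain ⟨u, hu0, hu⟩ := hPL.exists_eq_forall_mem_Icc_hasDerivWithinAt₀
  exact ⟨u, hu0, fun t ht => (hu t ⟨ht.1.le, ht.2.le⟩).hasDerivAt (Icc_mem_nhds ht.1 ht.2)⟩

theorem exists_global_solution [CompleteSpace E] (hv : IsBoundedField v L K) (t₀ : ℝ) (x : E) :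
    ∃ u : ℝ → E, u t₀ = x ∧ ∀ t, HasDerivAt u (v t (u t)) t := by
  choose w hw0 hw using fun n : {n : ℝ≥0 // |t₀| < n} => hv.exists_local_solution t₀ x n.2
  -- A window containing both `t₀` and `t`; the global solution reads off at `t` the solution on
  -- window `b t`.
  let b : ℝ → {n : ℝ≥0 // |t₀| < n} := fun t =>
    ⟨⟨|t₀| + |t| + 1, by positivity⟩, show |t₀| < |t₀| + |t| + 1 by linarith [abs_nonneg t]⟩
  have hb : ∀ t, ((b t : ℝ≥0) : ℝ) = |t₀| + |t| + 1 := fun t => rfl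
  have key : ∀ (n m : {n : ℝ≥0 // |t₀| < n}), n.1 ≤ m.1 →
      EqOn (w n) (w m) (Ioo (-(n.1 : ℝ)) n.1) := by
    intro n m hnm
    have hnm' : (n.1 : ℝ) ≤ m.1 := hnm
    refine hv.eqOn_of_hasDerivAt n.2 (hw n) (fun t ht => hw m t ⟨?_, ?_⟩) ((hw0 n).trans (hw0 m).symm)
    · linarith [ht.1]
    · linarith [ht.2]
  refine ⟨fun t => w (b t) t, hw0 _, fun t => ?_⟩
  -- One unit of room makes this single window contain the windows `b s` of all `s` near `t`, so the
  -- glued function agrees near `t` with one genuine solution.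
  let m : {n : ℝ≥0 // |t₀| < n} := ⟨(b t).1 + 1, by
    push_cast; rw [hb]; linarith [abs_nonneg t]⟩
  have hm : (m.1 : ℝ) = |t₀| + |t| + 1 + 1 := by simp [m, hb]
  have hEq : (fun t => w (b t) t) =ᶠ[𝓝 t] w m := by
    have : ∀ᶠ s in 𝓝 t, |s| < |t| + 1 :=
      (continuous_abs.tendsto t).eventually (gt_mem_nhds (by linarith))
    filter_upwards [this] with s hs
    refine key (b s) m ?_ ?_
    · rw [← NNReal.coe_le_coe, hm, hb]; linarith
    · rw [hb]; exact abs_lt.1 (by linarith [abs_nonneg t₀])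
  have := hw m t (abs_lt.1 (by rw [hm]; linarith [abs_nonneg t₀]))
  have h2 : w (b t) t = w m t := hEq.self_of_nhds
  change HasDerivAt _ (v t (w (b t) t)) t
  rw [h2]
  exact this.congr_of_eventuallyEq hEq

end IsBoundedField

open Classical in
/-- The flow of the vector field `v`: the position at time `t` of the solution of `u' = v(t, u)`
through `x` at time `s`. -/
def odeFlow (v : ℝ → E → E) (s : ℝ) (x : E) : ℝ → E :=
  if h : ∃ u : ℝ → E, u s = x ∧ ∀ t, HasDerivAt u (v t (u t)) t then h.choose else fun _ => x

namespace IsBoundedField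

variable [CompleteSpace E] {v : ℝ → E → E} {L K : ℝ≥0}

theorem odeFlow_spec (hv : IsBoundedField v L K) (s : ℝ) (x : E) :
    odeFlow v s x s = x ∧ ∀ t, HasDerivAt (odeFlow v s x) (v t (odeFlow v s x t)) t := by
  have h := hv.exists_global_solution s x
  rw [odeFlow, dif_pos h]
  exact h.choose_spec

theorem odeFlow_self (hv : IsBoundedField v L K) (s : ℝ) (x : E) : odeFlow v s x s = x :=
  (hv.odeFlow_spec s x).1

theorem hasDerivAt_odeFlow (hv : IsBoundedField v L K) (s : ℝ) (x : E) (t : ℝ) :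
    HasDerivAt (odeFlow v s x) (v t (odeFlow v s x t)) t :=
  (hv.odeFlow_spec s x).2 t

theorem odeFlow_odeFlow (hv : IsBoundedField v L K) (s : ℝ) (x : E) (t r : ℝ) :
    odeFlow v t (odeFlow v s x t) r = odeFlow v s x r := by
  let n : ℝ≥0 := ⟨|t| + |r| + 1, by positivity⟩
  have hn : (n : ℝ) = |t| + |r| + 1 := rfl
  refine hv.eqOn_of_hasDerivAt (n := n) (t₀ := t) (by rw [hn]; linarith [abs_nonneg r])
    (fun t _ => hv.hasDerivAt_odeFlow _ _ t) (fun t _ => hv.hasDerivAt_odeFlow _ _ t)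
    (hv.odeFlow_self _ _) (abs_lt.1 (by rw [hn]; linarith [abs_nonneg t]))

theorem norm_odeFlow_sub_le (hv : IsBoundedField v L K) (s : ℝ) (x : E) (t r : ℝ) :
    ‖odeFlow v s x r - odeFlow v s x t‖ ≤ L * |r - t| := by
  have := Convex.norm_image_sub_le_of_norm_hasDerivWithin_le (f := odeFlow v s x) (s := univ)
    (C := L) (fun t _ => (hv.hasDerivAt_odeFlow s x t).hasDerivWithinAt)
    (fun t _ => hv.norm_le _ _) convex_univ (mem_univ t) (mem_univ r)
  simpa [Real.norm_eq_abs] using this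

theorem norm_odeFlow_sub_self_le (hv : IsBoundedField v L K) (s : ℝ) (x : E) (r : ℝ) :
    ‖odeFlow v s x r - x‖ ≤ L * |r - s| := by
  simpa [hv.odeFlow_self] using hv.norm_odeFlow_sub_le s x s r

/-- Time reversal reduces the backward Grönwall estimate to the forward one. -/
theorem reverse (hv : IsBoundedField v L K) : IsBoundedField (fun t x => -v (-t) x) L K where
  norm_le t x := by rw [norm_neg]; exact hv.norm_le _ _
  lipschitz t x y := by
    rw [← neg_sub', norm_neg]; simpa using hv.lipschitz (-t) x y
  continuous := (hv.continuous.comp (by fun_prop : Continuous fun p : ℝ × E => (-p.1, p.2))).neg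

theorem dist_le_of_hasDerivAt (hv : IsBoundedField v L K) {f g : ℝ → E} {n : ℝ≥0} {s t : ℝ}
    (hs : |s| ≤ n) (ht : |t| ≤ n) (hst : s ≤ t) (hf : ∀ t, HasDerivAt f (v t (f t)) t)
    (hg : ∀ t, HasDerivAt g (v t (g t)) t) :
    dist (f t) (g t) ≤ dist (f s) (g s) * Real.exp ((K * n : ℝ≥0) * |t - s|) := by
  rw [abs_of_nonneg (sub_nonneg.2 hst)]
  refine dist_le_of_trajectories_ODE_of_mem (v := v) (s := fun _ => univ) (K := K * n) (b := t)
    (fun r hr => (hv.lipschitzWith (abs_le.2 ⟨?_, ?_⟩)).lipschitzOnWith)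
    (fun r _ => (hf r).continuousAt.continuousWithinAt) (fun r _ => (hf r).hasDerivWithinAt)
    (fun _ _ => mem_univ _)
    (fun r _ => (hg r).continuousAt.continuousWithinAt) (fun r _ => (hg r).hasDerivWithinAt)
    (fun _ _ => mem_univ _) le_rfl t ⟨hst, le_rfl⟩
  · linarith [(abs_le.1 hs).1, hr.1]
  · linarith [(abs_le.1 ht).2, hr.2]

theorem dist_odeFlow_le (hv : IsBoundedField v L K) {n : ℝ≥0} {s t : ℝ}
    (hs : |s| ≤ n) (ht : |t| ≤ n) (x y : E) :
    dist (odeFlow v s x t) (odeFlow v s y t) ≤ Real.exp ((K * n : ℝ≥0) * |t - s|) * dist x y := by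
  rw [mul_comm]
  rcases le_total s t with hst | hst
  · have := hv.dist_le_of_hasDerivAt hs ht hst (hv.hasDerivAt_odeFlow s x)
      (hv.hasDerivAt_odeFlow s y)
    rwa [hv.odeFlow_self, hv.odeFlow_self] at this
  · have hrev : ∀ x r, HasDerivAt (fun r => odeFlow v s x (-r)) (-v (-r) (odeFlow v s x (-r))) r := by
      intro x r
      have := (hv.hasDerivAt_odeFlow s x (-r)).scomp r (hasDerivAt_neg r)
      simpa using! this
    have := hv.reverse.dist_le_of_hasDerivAt (s := -s) (t := -t) (by rwa [abs_neg])
      (by rwa [abs_neg]) (neg_le_neg hst) (hrev x) (hrev y)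
    simp only [neg_neg, hv.odeFlow_self] at this
    rwa [show |-t - -s| = |t - s| by rw [← abs_neg]; congr 1; ring] at this

theorem exists_lipschitzWith_odeFlow (hv : IsBoundedField v L K) (s t : ℝ) :
    ∃ C : ℝ≥0, LipschitzWith C (fun x => odeFlow v s x t) :=
  ⟨⟨Real.exp ((K * ⟨max |s| |t|, by positivity⟩ : ℝ≥0) * |t - s|), by positivity⟩,
    LipschitzWith.of_dist_le_mul fun x y =>
      hv.dist_odeFlow_le (le_max_left _ _) (le_max_right _ _) x y⟩

theorem continuous_odeFlow_space (hv : IsBoundedField v L K) (s t : ℝ) :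
    Continuous (fun x => odeFlow v s x t) :=
  (hv.exists_lipschitzWith_odeFlow s t).choose_spec.continuous

theorem continuous_odeFlow (hv : IsBoundedField v L K) (s : ℝ) :
    Continuous (fun p : E × ℝ => odeFlow v s p.1 p.2) := by
  rw [continuous_iff_continuousAt]
  rintro ⟨x, t⟩
  rw [ContinuousAt, tendsto_iff_norm_sub_tendsto_zero]
  have h1 : Tendsto (fun p : E × ℝ => L * |p.2 - t| + ‖odeFlow v s p.1 t - odeFlow v s x t‖)
      (𝓝 (x, t)) (𝓝 0) := by
    have hc : Continuous
        (fun p : E × ℝ => L * |p.2 - t| + ‖odeFlow v s p.1 t - odeFlow v s x t‖) := by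
      have := (hv.continuous_odeFlow_space s t).comp (continuous_fst (X := E) (Y := ℝ))
      have h' : Continuous fun p : E × ℝ => odeFlow v s p.1 t := this
      fun_prop
    simpa using hc.tendsto (x, t)
  refine squeeze_zero (fun _ => norm_nonneg _) (fun p => ?_) h1
  calc ‖odeFlow v s p.1 p.2 - odeFlow v s x t‖
      = ‖(odeFlow v s p.1 p.2 - odeFlow v s p.1 t) + (odeFlow v s p.1 t - odeFlow v s x t)‖ := by
        congr 1; abel
    _ ≤ _ := (norm_add_le _ _).trans (by gcongr; exact hv.norm_odeFlow_sub_le _ _ _ _)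

/-- Pulling a differentiable curve back to a fixed time along the flow. -/
theorem hasDerivAt_odeFlow_start (hv : IsBoundedField v L K) {c : ℝ → E} {c' : E} {s : ℝ}
    (hc : HasDerivAt c c' s) :
    HasDerivAt (fun r => odeFlow v r (c r) s) (c' - v s (c s)) s := by
  rw [hasDerivAt_iff_isLittleO, Asymptotics.isLittleO_iff]
  intro ε hε
  have hcont : ContinuousAt (Function.uncurry v) (s, c s) := hv.continuous.continuousAt
  obtain ⟨δ, hδ, hδv⟩ := Metric.continuousAt_iff.1 hcont (ε / 2) (by positivity)
  have h1 := (Asymptotics.isLittleO_iff.1 (hasDerivAt_iff_isLittleO.1 hc))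
    (show (0 : ℝ) < ε / 2 by positivity)
  have h2 : ∀ᶠ r in 𝓝 s, ‖c r - c s‖ < δ / 2 := by
    have := Metric.continuousAt_iff.1 hc.continuousAt (δ / 2) (by positivity)
    obtain ⟨η, hη, h⟩ := this
    filter_upwards [Metric.ball_mem_nhds s hη] with r hr
    rw [← dist_eq_norm]; exact h hr
  have h3 : ∀ᶠ r in 𝓝 s, |r - s| < δ ∧ L * |r - s| < δ / 2 := by
    have hc1 : Tendsto (fun r : ℝ => |r - s|) (𝓝 s) (𝓝 0) := by
      have : Continuous fun r : ℝ => |r - s| := by fun_prop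
      simpa using this.tendsto s
    have hc2 : Tendsto (fun r : ℝ => L * |r - s|) (𝓝 s) (𝓝 0) := by
      simpa using hc1.const_mul (L : ℝ)
    exact (hc1.eventually (gt_mem_nhds hδ)).and (hc2.eventually (gt_mem_nhds (by positivity)))
  filter_upwards [h1, h2, h3] with r hr1 hr2 hr3
  -- Mean value inequality for the flow line minus its linear model with velocity `v s (c s)`:
  -- between times `r` and `s` the line stays `δ`-close to `c s`, so the velocity error is at most
  -- `ε / 2`.
  have hmv : ‖(odeFlow v r (c r) s - s • v s (c s)) - (odeFlow v r (c r) r - r • v s (c s))‖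
      ≤ ε / 2 * ‖s - r‖ := by
    refine Convex.norm_image_sub_le_of_norm_hasDerivWithin_le
      (f := fun ρ => odeFlow v r (c r) ρ - ρ • v s (c s)) (s := uIcc r s)
      (f' := fun ρ => v ρ (odeFlow v r (c r) ρ) - v s (c s)) (fun ρ _ => ?_) (fun ρ hρ => ?_)
      (convex_uIcc _ _) left_mem_uIcc right_mem_uIcc
    · have := (hv.hasDerivAt_odeFlow r (c r) ρ).sub ((hasDerivAt_id ρ).smul_const (v s (c s)))
      simpa using! this.hasDerivWithinAt
    · have hρ1 : |ρ - s| ≤ |r - s| := by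
        rw [abs_sub_comm r s]; rw [uIcc_comm] at hρ
        exact (abs_sub_left_of_mem_uIcc hρ).trans (abs_sub_comm _ _).le
      have hρ2 : |ρ - r| ≤ |r - s| := by
        rw [abs_sub_comm r s]; exact abs_sub_left_of_mem_uIcc hρ
      rw [← dist_eq_norm]
      refine (hδv (x := (ρ, odeFlow v r (c r) ρ)) ?_).le
      rw [Prod.dist_eq, max_lt_iff, Real.dist_eq, dist_eq_norm]
      refine ⟨hρ1.trans_lt hr3.1, ?_⟩
      calc ‖odeFlow v r (c r) ρ - c s‖ = ‖(odeFlow v r (c r) ρ - c r) + (c r - c s)‖ := by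
            congr 1; abel
        _ ≤ L * |ρ - r| + ‖c r - c s‖ :=
            (norm_add_le _ _).trans (by gcongr; exact hv.norm_odeFlow_sub_self_le _ _ _)
        _ ≤ L * |r - s| + ‖c r - c s‖ := by gcongr
        _ < δ := by linarith [hr3.2]
  rw [hv.odeFlow_self] at hmv
  rw [hv.odeFlow_self]
  calc ‖odeFlow v r (c r) s - c s - (r - s) • (c' - v s (c s))‖
      = ‖((odeFlow v r (c r) s - s • v s (c s)) - (c r - r • v s (c s)))
          + (c r - c s - (r - s) • c')‖ := by
        congr 1; simp only [sub_smul, smul_sub]; abel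
    _ ≤ ε / 2 * ‖s - r‖ + ε / 2 * ‖r - s‖ := (norm_add_le _ _).trans (add_le_add hmv hr1)
    _ = ε * ‖r - s‖ := by rw [norm_sub_rev s r]; ring

theorem norm_odeFlow_start_sub_le (hv : IsBoundedField v L K) (s r : ℝ) (x y : E) :
    ‖odeFlow v r x s - y‖ ≤ L * |r - s| + ‖x - y‖ := by
  calc ‖odeFlow v r x s - y‖ = ‖(odeFlow v r x s - x) + (x - y)‖ := by congr 1; abel
    _ ≤ _ := (norm_add_le _ _).trans (by
      gcongr; rw [abs_sub_comm]; exact hv.norm_odeFlow_sub_self_le _ _ _)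

end IsBoundedField

end Flow

/-! ### Density of the standard Gaussian and its translates (Cameron–Martin). -/

section Gaussian

variable {E : Type*} [NormedAddCommGroup E] [InnerProductSpace ℝ E] [FiniteDimensional ℝ E]
  [MeasurableSpace E] [BorelSpace E]

/-- The standard Gaussian density. -/
def stdGaussianPDF (x : E) : ℝ :=
  (2 * Real.pi) ^ (-(Module.finrank ℝ E : ℝ) / 2) * Real.exp (-‖x‖ ^ 2 / 2)

theorem stdGaussianPDF_nonneg (x : E) : 0 ≤ stdGaussianPDF x := by
  unfold stdGaussianPDF; positivity

theorem continuous_stdGaussianPDF : Continuous (stdGaussianPDF : E → ℝ) := by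
  unfold stdGaussianPDF; fun_prop

theorem ofReal_stdGaussianPDF_mul_cexp (x ξ : E) :
    (stdGaussianPDF x : ℂ) * Complex.exp (⟪x, ξ⟫ * Complex.I) =
      ((2 * Real.pi) ^ (-(Module.finrank ℝ E : ℝ) / 2) : ℝ) *
        Complex.exp (-(1 / 2 : ℂ) * ‖x‖ ^ 2 + Complex.I * ⟪ξ, x⟫) := by
  rw [stdGaussianPDF, Complex.ofReal_mul, mul_assoc]
  congr 1
  rw [Complex.ofReal_exp, ← Complex.exp_add, real_inner_comm]
  congr 1
  push_cast
  ring

theorem integrable_stdGaussianPDF : Integrable (stdGaussianPDF : E → ℝ) := by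
  have h := (GaussianFourier.integrable_cexp_neg_mul_sq_norm_add (V := E) (b := 1 / 2)
    (by norm_num) Complex.I 0).const_mul
      (((2 * Real.pi) ^ (-(Module.finrank ℝ E : ℝ) / 2) : ℝ) : ℂ)
  have h2 : Integrable (fun x : E => ((stdGaussianPDF x : ℝ) : ℂ)) := by
    refine h.congr (ae_of_all _ fun x => ?_)
    simpa using (ofReal_stdGaussianPDF_mul_cexp x (0 : E)).symm
  simpa using h2.re

/-- Both sides are finite measures with the characteristic function `exp(-‖ξ‖² / 2)`. -/
theorem stdGaussian_eq_withDensity :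
    stdGaussian E = volume.withDensity (fun x => ENNReal.ofReal (stdGaussianPDF x)) := by
  have : IsFiniteMeasure (volume.withDensity (fun x : E => ENNReal.ofReal (stdGaussianPDF x))) :=
    isFiniteMeasure_withDensity_ofReal integrable_stdGaussianPDF.2
  refine Measure.ext_of_charFun (funext fun ξ => ?_)
  rw [charFun_stdGaussian, charFun_apply,
    integral_withDensity_eq_integral_toReal_smul (by
      exact (continuous_stdGaussianPDF.measurable).ennreal_ofReal) (by simp)]
  simp_rw [ENNReal.toReal_ofReal (stdGaussianPDF_nonneg _), Complex.real_smul,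
    ofReal_stdGaussianPDF_mul_cexp]
  rw [integral_const_mul, GaussianFourier.integral_cexp_neg_mul_sq_norm_add (by norm_num),
    ← mul_assoc]
  have hpi : (Real.pi / (1 / 2 : ℂ)) = ((2 * Real.pi : ℝ) : ℂ) := by push_cast; ring
  rw [hpi, show ((Module.finrank ℝ E : ℂ) / 2) = (((Module.finrank ℝ E : ℝ) / 2 : ℝ) : ℂ) by
    push_cast; ring, ← Complex.ofReal_cpow (by positivity), ← Complex.ofReal_mul,
    ← Real.rpow_add (by positivity), show -(Module.finrank ℝ E : ℝ) / 2 +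
      (Module.finrank ℝ E : ℝ) / 2 = 0 by ring, Real.rpow_zero, Complex.ofReal_one, one_mul,
    Complex.I_sq]
  congr 1
  ring

theorem stdGaussian_absolutelyContinuous : stdGaussian E ≪ volume := by
  rw [stdGaussian_eq_withDensity]
  exact withDensity_absolutelyContinuous _ _

/-- The density of `N(c, I)` with respect to `N(0, I)`. -/
def shiftDensity (c z : E) : ℝ := Real.exp (⟪c, z⟫ - ‖c‖ ^ 2 / 2)

theorem lintegral_stdGaussian (φ : E → ℝ≥0∞) (hφ : Measurable φ) :
    ∫⁻ z, φ z ∂stdGaussian E = ∫⁻ z, ENNReal.ofReal (stdGaussianPDF z) * φ z := by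
  rw [stdGaussian_eq_withDensity, lintegral_withDensity_eq_lintegral_mul _
    continuous_stdGaussianPDF.measurable.ennreal_ofReal hφ]
  rfl

theorem measurable_shiftDensity (c : E) : Measurable (shiftDensity c) := by
  have : Continuous (shiftDensity c) := by unfold shiftDensity; fun_prop
  exact this.measurable

/-- Translation invariance of Lebesgue measure and completion of the square in the exponent. -/
theorem lintegral_stdGaussian_add (φ : E → ℝ≥0∞) (hφ : Measurable φ) (c : E) :
    ∫⁻ z, φ (z + c) ∂stdGaussian E =
      ∫⁻ z, ENNReal.ofReal (shiftDensity c z) * φ z ∂stdGaussian E := by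
  rw [lintegral_stdGaussian (fun z => φ (z + c)) (hφ.comp (measurable_add_const c)),
    lintegral_stdGaussian (fun z => ENNReal.ofReal (shiftDensity c z) * φ z)
      ((measurable_shiftDensity c).ennreal_ofReal.mul hφ),
    ← lintegral_add_right_eq_self
      (fun z => ENNReal.ofReal (stdGaussianPDF z) * (ENNReal.ofReal (shiftDensity c z) * φ z)) c]
  refine lintegral_congr fun z => ?_
  rw [← mul_assoc, ← ENNReal.ofReal_mul (stdGaussianPDF_nonneg _)]
  congr 2
  unfold stdGaussianPDF shiftDensity
  rw [mul_assoc, ← Real.exp_add]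
  congr 2
  rw [norm_add_sq_real, inner_add_right, real_inner_self_eq_norm_sq, real_inner_comm]
  ring

theorem stdGaussian_map_add_right (c : E) :
    (stdGaussian E).map (fun z => z + c) =
      (stdGaussian E).withDensity (fun z => ENNReal.ofReal (shiftDensity c z)) := by
  ext s hs
  rw [Measure.map_apply (measurable_add_const c) hs, withDensity_apply _ hs,
    ← lintegral_indicator_one (measurable_add_const c hs), ← lintegral_indicator hs]
  have := lintegral_stdGaussian_add (s.indicator 1) (measurable_one.indicator hs) c
  refine (lintegral_congr fun z => ?_).trans (this.trans (lintegral_congr fun z => ?_))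
  · rfl
  · by_cases hz : z ∈ s <;> simp [hz]

variable {F : Type*} [NormedAddCommGroup F] [NormedSpace ℝ F]

theorem shiftDensity_pos (c z : E) : 0 < shiftDensity c z := Real.exp_pos _

theorem integral_stdGaussian_add (φ : E → F) (hφ : StronglyMeasurable φ) (c : E) :
    ∫ z, φ (z + c) ∂stdGaussian E = ∫ z, shiftDensity c z • φ z ∂stdGaussian E := by
  rw [← integral_map (φ := fun z => z + c) (f := φ) (measurable_add_const c).aemeasurable
    hφ.aestronglyMeasurable, stdGaussian_map_add_right,
    integral_withDensity_eq_integral_toReal_smul (measurable_shiftDensity c).ennreal_ofReal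
      (by simp)]
  simp_rw [ENNReal.toReal_ofReal (shiftDensity_pos _ _).le]

end Gaussian

/-! ### The posterior mean as a bounded Lipschitz field, and as a logarithmic gradient. -/

section PosteriorMean

variable {E : Type*} [NormedAddCommGroup E] [InnerProductSpace ℝ E] [FiniteDimensional ℝ E]
  [MeasurableSpace E] [BorelSpace E]

/-- The exponent is `‖z‖² / 2 - ‖c - z‖² / 2`. The bound is uniform in `c`, hence dominates the
weights for all `y` at once. -/
theorem shiftDensity_le (c z : E) : shiftDensity c z ≤ Real.exp (‖z‖ ^ 2 / 2) := by
  refine Real.exp_le_exp.2 ?_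
  have := norm_sub_sq_real c z
  nlinarith [sq_nonneg ‖c - z‖]

theorem continuous_shiftDensity :
    Continuous (fun p : (ℝ × E) × E => shiftDensity (p.1.1 • p.2) p.1.2) := by
  unfold shiftDensity
  fun_prop

/-- The density at `u` of `r y + z`, `y ∼ P`, `z ∼ N(0, I)`, with respect to `N(0, I)`. -/
def partitionFn (P : Measure E) (r : ℝ) (u : E) : ℝ := ∫ y, shiftDensity (r • y) u ∂P

/-- The weighted first moment of `P` under the posterior weights. -/
def posteriorMoment (P : Measure E) (r : ℝ) (u : E) : E := ∫ y, shiftDensity (r • y) u • y ∂P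

/-- The posterior mean `E[y | r y + z = u]`, `y ∼ P`, `z ∼ N(0, I)`. -/
def posteriorMean (P : Measure E) (r : ℝ) (u : E) : E :=
  (partitionFn P r u)⁻¹ • posteriorMoment P r u

variable {P : Measure E} [IsProbabilityMeasure P] {R : ℝ≥0}

theorem continuous_shiftDensity_right (r : ℝ) (u : E) :
    Continuous (fun y : E => shiftDensity (r • y) u) :=
  continuous_shiftDensity.comp (by fun_prop : Continuous fun y : E => ((r, u), y))

theorem integrable_shiftDensity (P : Measure E) [IsProbabilityMeasure P] (r : ℝ) (u : E) :
    Integrable (fun y => shiftDensity (r • y) u) P := by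
  refine Integrable.of_bound (continuous_shiftDensity_right r u).aestronglyMeasurable
    (Real.exp (‖u‖ ^ 2 / 2)) (ae_of_all _ fun y => ?_)
  rw [Real.norm_of_nonneg (shiftDensity_pos _ _).le]
  exact shiftDensity_le _ _

theorem integrable_shiftDensity_smul (hP : ∀ᵐ y ∂P, ‖y‖ ≤ R) (r : ℝ) (u : E) :
    Integrable (fun y => shiftDensity (r • y) u • y) P := by
  refine Integrable.of_bound ((continuous_shiftDensity_right r u).smul
    continuous_id).aestronglyMeasurable (Real.exp (‖u‖ ^ 2 / 2) * R) ?_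
  filter_upwards [hP] with y hy
  rw [norm_smul, Real.norm_of_nonneg (shiftDensity_pos _ _).le]
  gcongr
  exact shiftDensity_le _ _

theorem partitionFn_pos (P : Measure E) [IsProbabilityMeasure P] (r : ℝ) (u : E) :
    0 < partitionFn P r u :=
  integral_exp_pos (integrable_shiftDensity P r u)

theorem partitionFn_smul_posteriorMean (r : ℝ) (u : E) :
    partitionFn P r u • posteriorMean P r u = posteriorMoment P r u := by
  rw [posteriorMean, smul_smul, mul_inv_cancel₀ (partitionFn_pos P r u).ne', one_smul]

theorem norm_posteriorMean_le (hP : ∀ᵐ y ∂P, ‖y‖ ≤ R) (r : ℝ) (u : E) :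
    ‖posteriorMean P r u‖ ≤ R := by
  have hZ := partitionFn_pos P r u
  rw [posteriorMean, norm_smul, norm_inv, Real.norm_of_nonneg hZ.le, inv_mul_le_iff₀ hZ,
    partitionFn, ← integral_mul_const]
  refine norm_integral_le_of_norm_le ((integrable_shiftDensity P r u).mul_const _) ?_
  filter_upwards [hP] with y hy
  rw [norm_smul, Real.norm_of_nonneg (shiftDensity_pos _ _).le]
  exact mul_le_mul_of_nonneg_left hy (shiftDensity_pos _ _).le

/-- The sum on the right, rather than a constant, keeps the bound relative: integrated over `y` it
gives the two partition functions, which are then divided out. -/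
theorem abs_exp_sub_exp_le (a b : ℝ) :
    |Real.exp a - Real.exp b| ≤ |a - b| * (Real.exp a + Real.exp b) := by
  wlog h : b ≤ a generalizing a b
  · rw [abs_sub_comm, abs_sub_comm a, add_comm]
    exact this b a (le_of_not_ge h)
  rw [abs_of_nonneg (sub_nonneg.2 (Real.exp_le_exp.2 h)), abs_of_nonneg (sub_nonneg.2 h)]
  have h1 := Real.add_one_le_exp (b - a)
  have h2 : Real.exp b = Real.exp (b - a) * Real.exp a := by rw [← Real.exp_add]; ring_nf
  nlinarith [Real.exp_pos a, Real.exp_pos b, mul_nonneg (sub_nonneg.2 h) (Real.exp_pos b).le]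

theorem abs_shiftDensity_sub_le (r : ℝ) (u u' y : E) :
    |shiftDensity (r • y) u - shiftDensity (r • y) u'| ≤
      |r| * ‖y‖ * ‖u - u'‖ * (shiftDensity (r • y) u + shiftDensity (r • y) u') := by
  refine (abs_exp_sub_exp_le _ _).trans ?_
  refine mul_le_mul_of_nonneg_right ?_ (add_pos (Real.exp_pos _) (Real.exp_pos _)).le
  rw [sub_sub_sub_cancel_right, ← inner_sub_right]
  refine (abs_real_inner_le_norm _ _).trans ?_
  rw [norm_smul, Real.norm_eq_abs]

/-- With `m` the mean at `u'`, the centred moment `∫ w_{u'} (y - m)` vanishes, so `Z(u)` times the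
difference of means is `∫ (w_u - w_{u'}) (y - m)`. The weights differ by a factor `|r| R ‖u - u'‖`
relative to their sum, `‖y - m‖ ≤ 2R`, and taking `u` to have the larger partition function bounds
`Z(u) + Z(u')` by `2 Z(u)`; the product of constants is `4R²`. -/
theorem norm_posteriorMean_sub_le (hP : ∀ᵐ y ∂P, ‖y‖ ≤ R) (r : ℝ) (u u' : E) :
    ‖posteriorMean P r u - posteriorMean P r u'‖ ≤ (4 * R ^ 2 : ℝ≥0) * |r| * ‖u - u'‖ := by
  wlog h : partitionFn P r u' ≤ partitionFn P r u generalizing u u'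
  · rw [norm_sub_rev, norm_sub_rev u]
    exact this u' u (le_of_not_ge h)
  have hZ := partitionFn_pos P r u
  set m := posteriorMean P r u' with hm
  have hI : ∀ u, Integrable (fun y => shiftDensity (r • y) u • (y - m)) P := fun u => by
    simp_rw [smul_sub]
    exact (integrable_shiftDensity_smul hP r u).sub ((integrable_shiftDensity P r u).smul_const _)
  have hint : ∀ u, ∫ y, shiftDensity (r • y) u • (y - m) ∂P
      = posteriorMoment P r u - partitionFn P r u • m := fun u => by
    simp_rw [smul_sub]
    rw [integral_sub (integrable_shiftDensity_smul hP r u)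
      ((integrable_shiftDensity P r u).smul_const _), integral_smul_const]
    rfl
  have h0 : ∫ y, shiftDensity (r • y) u' • (y - m) ∂P = 0 := by
    rw [hint, hm, partitionFn_smul_posteriorMean, sub_self]
  have h1 : partitionFn P r u • (posteriorMean P r u - m) =
      ∫ y, (shiftDensity (r • y) u - shiftDensity (r • y) u') • (y - m) ∂P := by
    simp_rw [sub_smul]
    rw [integral_sub (hI u) (hI u'), h0, hint, smul_sub, partitionFn_smul_posteriorMean, sub_zero]
  have h2 : ‖partitionFn P r u • (posteriorMean P r u - m)‖ ≤
      |r| * R * ‖u - u'‖ * (2 * R) * (partitionFn P r u + partitionFn P r u') := by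
    rw [h1, partitionFn, partitionFn, ← integral_add (integrable_shiftDensity P r u)
      (integrable_shiftDensity P r u'), ← integral_const_mul]
    refine norm_integral_le_of_norm_le (((integrable_shiftDensity P r u).add
      (integrable_shiftDensity P r u')).const_mul _) ?_
    filter_upwards [hP] with y hy
    have hpos : 0 ≤ shiftDensity (r • y) u + shiftDensity (r • y) u' :=
      (add_pos (Real.exp_pos _) (Real.exp_pos _)).le
    have hym : ‖y - m‖ ≤ 2 * R := by
      refine (norm_sub_le _ _).trans ?_
      linarith [norm_posteriorMean_le hP r u']
    rw [norm_smul, Real.norm_eq_abs]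
    calc _ ≤ (|r| * ‖y‖ * ‖u - u'‖ * (shiftDensity (r • y) u + shiftDensity (r • y) u')) *
          (2 * R) := by gcongr; exact abs_shiftDensity_sub_le r u u' y
      _ ≤ (|r| * R * ‖u - u'‖ * (shiftDensity (r • y) u + shiftDensity (r • y) u')) *
          (2 * R) := by gcongr
      _ = _ := by ring
  rw [norm_smul, Real.norm_of_nonneg hZ.le] at h2
  have h3 : |r| * R * ‖u - u'‖ * (2 * R) * (partitionFn P r u + partitionFn P r u') ≤
      |r| * R * ‖u - u'‖ * (2 * R) * (2 * partitionFn P r u) := by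
    gcongr; linarith
  refine le_of_mul_le_mul_left (h2.trans (h3.trans_eq ?_)) hZ
  push_cast
  ring

/-- Gives access to continuity of parametric integrals over compact sets. -/
theorem restrict_closedBall_eq (hP : ∀ᵐ y ∂P, ‖y‖ ≤ R) :
    P.restrict (Metric.closedBall 0 R) = P :=
  Measure.restrict_eq_self_of_ae_mem (by simpa using hP)

theorem continuous_partitionFn (hP : ∀ᵐ y ∂P, ‖y‖ ≤ R) :
    Continuous (fun p : ℝ × E => partitionFn P p.1 p.2) := by
  have := continuous_parametric_integral_of_continuous (μ := P)
    (f := fun (p : ℝ × E) (y : E) => shiftDensity (p.1 • y) p.2) continuous_shiftDensity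
    (isCompact_closedBall (0 : E) R)
  rwa [restrict_closedBall_eq hP] at this

theorem continuous_posteriorMoment (hP : ∀ᵐ y ∂P, ‖y‖ ≤ R) :
    Continuous (fun p : ℝ × E => posteriorMoment P p.1 p.2) := by
  have := continuous_parametric_integral_of_continuous (μ := P)
    (f := fun (p : ℝ × E) (y : E) => shiftDensity (p.1 • y) p.2 • y)
    (continuous_shiftDensity.smul continuous_snd) (isCompact_closedBall (0 : E) R)
  rwa [restrict_closedBall_eq hP] at this

theorem isBoundedField_posteriorMean (hP : ∀ᵐ y ∂P, ‖y‖ ≤ R) :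
    IsBoundedField (posteriorMean P) R (4 * R ^ 2) where
  norm_le := norm_posteriorMean_le hP
  lipschitz := norm_posteriorMean_sub_le hP
  continuous := ((continuous_partitionFn hP).inv₀ fun p => (partitionFn_pos P p.1 p.2).ne').smul
    (continuous_posteriorMoment hP)

theorem hasFDerivAt_shiftDensity (c u : E) :
    HasFDerivAt (shiftDensity c) (shiftDensity c u • innerSL ℝ c) u := by
  have h := ((innerSL ℝ c).hasFDerivAt (x := u)).sub_const (‖c‖ ^ 2 / 2)
  exact h.exp

/-- Differentiation under the integral brings down `r y`, and the logarithm normalizes the weights.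
This is Tweedie's formula relative to the Gaussian. -/
theorem hasGradientAt_log_partitionFn (hP : ∀ᵐ y ∂P, ‖y‖ ≤ R) (r : ℝ) (u : E) :
    HasGradientAt (fun x => Real.log (partitionFn P r x)) (r • posteriorMean P r u) u := by
  have h1 : HasFDerivAt (partitionFn P r)
      (∫ y, shiftDensity (r • y) u • innerSL ℝ (r • y) ∂P) u := by
    refine hasFDerivAt_integral_of_dominated_of_fderiv_le (s := Metric.ball u 1)
      (bound := fun _ => Real.exp ((‖u‖ + 1) ^ 2 / 2) * (|r| * R))
      (F' := fun x y => shiftDensity (r • y) x • innerSL ℝ (r • y)) (Metric.ball_mem_nhds u one_pos)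
      (Eventually.of_forall fun x => (continuous_shiftDensity_right r x).aestronglyMeasurable)
      (integrable_shiftDensity P r u) ?_ ?_ (integrable_const _) ?_
    · refine Continuous.aestronglyMeasurable ?_
      exact (continuous_shiftDensity_right r u).smul (by fun_prop)
    · filter_upwards [hP] with y hy x hx
      rw [norm_smul, Real.norm_of_nonneg (shiftDensity_pos _ _).le, innerSL_apply_norm, norm_smul,
        Real.norm_eq_abs]
      have hx' : ‖x‖ ≤ ‖u‖ + 1 := by
        have : ‖u - x‖ < 1 := by rwa [← dist_eq_norm, dist_comm]
        have := norm_le_norm_add_norm_sub u x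
        linarith
      gcongr
      refine (shiftDensity_le _ _).trans ?_
      gcongr
    · exact ae_of_all _ fun y x _ => hasFDerivAt_shiftDensity _ _
  have h2 : (∫ y, shiftDensity (r • y) u • innerSL ℝ (r • y) ∂P) =
      innerSL ℝ (r • posteriorMoment P r u) := by
    rw [posteriorMoment, ← integral_smul, ← ContinuousLinearMap.integral_comp_comm]
    · refine integral_congr_ae (ae_of_all _ fun y => ?_)
      simp only [map_smul]
      rw [smul_comm]
    · exact (integrable_shiftDensity_smul hP r u).smul r
  have h3 := h1.log (partitionFn_pos P r u).ne'
  rw [hasGradientAt_iff_hasFDerivAt]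
  rw [h2] at h3
  convert! h3 using 1
  ext x
  simp only [InnerProductSpace.toDual_apply_apply, posteriorMean, smul_apply,
    innerSL_apply_apply, real_inner_smul_left, smul_eq_mul]
  ring

end PosteriorMean

/-! ### The flow of the posterior mean transports the noisy laws. -/

section Transport

variable {E : Type*} [NormedAddCommGroup E] [InnerProductSpace ℝ E] [FiniteDimensional ℝ E]
  [MeasurableSpace E] [BorelSpace E] {P : Measure E} [IsProbabilityMeasure P] {R : ℝ≥0}

theorem measurable_shiftDensity_prod (r : ℝ) :
    Measurable (fun p : E × E => shiftDensity (r • p.1) p.2) :=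
  (continuous_shiftDensity.comp
    (by fun_prop : Continuous fun p : E × E => ((r, p.2), p.1))).measurable

/-- The joint law of `(y, r y + z)` has the density `shiftDensity (r y) u` with respect to
`P ⊗ N(0, I)`. -/
theorem map_prod_stdGaussian (r : ℝ) :
    (P.prod (stdGaussian E)).map (fun p => (p.1, r • p.1 + p.2)) =
      (P.prod (stdGaussian E)).withDensity
        (fun p => ENNReal.ofReal (shiftDensity (r • p.1) p.2)) := by
  refine Measure.ext_of_lintegral _ fun φ hφ => ?_
  have hw := (measurable_shiftDensity_prod (E := E) r).ennreal_ofReal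
  have hm : Measurable (fun p : E × E => (p.1, r • p.1 + p.2)) := by fun_prop
  rw [lintegral_map hφ hm, lintegral_withDensity_eq_lintegral_mul _ hw hφ,
    lintegral_prod (fun p => φ (p.1, r • p.1 + p.2)) (hφ.comp hm).aemeasurable, lintegral_prod _ (hw.mul hφ).aemeasurable]
  refine lintegral_congr fun y => ?_
  have := lintegral_stdGaussian_add (fun z => φ (y, z)) (hφ.comp measurable_prodMk_left) (r • y)
  simpa [add_comm] using! this

variable {F : Type*} [NormedAddCommGroup F] [NormedSpace ℝ F] [CompleteSpace F]

theorem integrable_shiftDensity_prod (r : ℝ) {H : E × E → F}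
    (hH : StronglyMeasurable H) {C : ℝ} (hC : ∀ᵐ y ∂P, ∀ x, ‖H (y, x)‖ ≤ C) :
    Integrable (fun p => shiftDensity (r • p.1) p.2 • H p) (P.prod (stdGaussian E)) := by
  have hw := (measurable_shiftDensity_prod (E := E) r).ennreal_ofReal
  have hm : Measurable (fun p : E × E => (p.1, r • p.1 + p.2)) := by fun_prop
  have h1 : Integrable H ((P.prod (stdGaussian E)).map (fun p => (p.1, r • p.1 + p.2))) := by
    rw [integrable_map_measure hH.aestronglyMeasurable hm.aemeasurable]
    refine Integrable.of_bound (hH.comp_measurable hm).aestronglyMeasurable C ?_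
    filter_upwards [Measure.quasiMeasurePreserving_fst.ae hC] with p hp using hp _
  rw [map_prod_stdGaussian, integrable_withDensity_iff_integrable_smul' hw (by simp)] at h1
  simpa [ENNReal.toReal_ofReal (shiftDensity_pos _ _).le] using h1

theorem integral_prod_stdGaussian (r : ℝ) {H : E × E → F}
    (hH : StronglyMeasurable H) {C : ℝ} (hC : ∀ᵐ y ∂P, ∀ x, ‖H (y, x)‖ ≤ C) :
    ∫ p, H (p.1, r • p.1 + p.2) ∂(P.prod (stdGaussian E)) =
      ∫ x, ∫ y, shiftDensity (r • y) x • H (y, x) ∂P ∂stdGaussian E := by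
  have hw := (measurable_shiftDensity_prod (E := E) r).ennreal_ofReal
  have hm : Measurable (fun p : E × E => (p.1, r • p.1 + p.2)) := by fun_prop
  rw [← integral_map (φ := fun p : E × E => (p.1, r • p.1 + p.2)) hm.aemeasurable
    hH.aestronglyMeasurable, map_prod_stdGaussian,
    integral_withDensity_eq_integral_toReal_smul hw (by simp)]
  simp_rw [ENNReal.toReal_ofReal (shiftDensity_pos _ _).le]
  exact integral_prod_symm _ (integrable_shiftDensity_prod r hH hC)

theorem stronglyMeasurable_clm_apply {α : Type*} [MeasurableSpace α] {G : α → E →L[ℝ] F}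
    {g : α → E} (hG : StronglyMeasurable G) (hg : StronglyMeasurable g) :
    StronglyMeasurable (fun a => G a (g a)) :=
  isBoundedBilinearMap_apply.continuous.comp_stronglyMeasurable (hG.prodMk hg)

/-- Differentiability is asked only at `x₀`, with a Lipschitz bound centred there. This is what
Rademacher's theorem can supply: at a fixed parameter almost every integrand is differentiable, with
no common neighbourhood. -/
theorem hasDerivAt_integral_of_dominated_of_norm_sub_le {α : Type*} [MeasurableSpace α]
    {μ : Measure α} {f : ℝ → α → F} {f' : α → F} {bound : α → ℝ} {x₀ : ℝ}
    (hf : ∀ x, AEStronglyMeasurable (f x) μ) (hint : Integrable (f x₀) μ)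
    (hf' : AEStronglyMeasurable f' μ) (hle : ∀ᵐ a ∂μ, ∀ x, ‖f x a - f x₀ a‖ ≤ bound a * ‖x - x₀‖)
    (hbound : Integrable bound μ) (hderiv : ∀ᵐ a ∂μ, HasDerivAt (fun x => f x a) (f' a) x₀) :
    HasDerivAt (fun x => ∫ a, f x a ∂μ) (∫ a, f' a ∂μ) x₀ := by
  set L : F →L[ℝ] ℝ →L[ℝ] F := ContinuousLinearMap.smulRightL ℝ ℝ F 1
  have hm : AEStronglyMeasurable (L ∘ f') μ := L.continuous.comp_aestronglyMeasurable hf'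
  obtain ⟨h1, h2⟩ := hasFDerivAt_integral_of_dominated_loc_of_lip' univ_mem (fun x _ => hf x) hint
    hm (hle.mono fun a ha x _ => ha x) hbound (hderiv.mono fun a ha => ha.hasFDerivAt)
  have h3 : Integrable f' μ := by
    rw [← integrable_norm_iff hm] at h1
    simpa [L, (· ∘ ·), integrable_norm_iff hf'] using! h1
  rw [hasDerivAt_iff_hasFDerivAt]
  simpa only [(· ∘ ·), ContinuousLinearMap.integral_comp_comm _ h3] using! h2

theorem measurable_posteriorMean (hP : ∀ᵐ y ∂P, ‖y‖ ≤ R) (r : ℝ) :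
    Measurable (posteriorMean P r) :=
  ((isBoundedField_posteriorMean hP).continuous.comp
    (by fun_prop : Continuous fun x : E => (r, x))).measurable

/-- The tower property: `posteriorMean P r` is the conditional expectation of `y` given
`r y + z`. -/
theorem integral_apply_posteriorMean (hP : ∀ᵐ y ∂P, ‖y‖ ≤ R) (r : ℝ) {G : E → E →L[ℝ] F}
    (hG : StronglyMeasurable G) {C : ℝ} (hC : ∀ x, ‖G x‖ ≤ C) :
    ∫ p, G (r • p.1 + p.2) p.1 ∂(P.prod (stdGaussian E)) =
      ∫ p, G (r • p.1 + p.2) (posteriorMean P r (r • p.1 + p.2)) ∂(P.prod (stdGaussian E)) := by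
  have hG2 : StronglyMeasurable (fun p : E × E => G p.2) := hG.comp_measurable measurable_snd
  have hC0 : 0 ≤ C := (norm_nonneg _).trans (hC 0)
  have hb : ∀ x y : E, ‖y‖ ≤ R → ‖G x y‖ ≤ C * R := fun x y hy =>
    ((G x).le_opNorm y).trans (mul_le_mul (hC x) hy (norm_nonneg _) hC0)
  have h1 : StronglyMeasurable (fun p : E × E => G p.2 p.1) :=
    stronglyMeasurable_clm_apply hG2 measurable_fst.stronglyMeasurable
  have h2 : StronglyMeasurable (fun p : E × E => G p.2 (posteriorMean P r p.2)) :=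
    stronglyMeasurable_clm_apply hG2
      ((measurable_posteriorMean hP r).comp measurable_snd).stronglyMeasurable
  rw [integral_prod_stdGaussian r (H := fun p => G p.2 p.1) h1 (C := C * R)
      (hP.mono fun y hy x => hb _ _ hy),
    integral_prod_stdGaussian r (H := fun p => G p.2 (posteriorMean P r p.2)) h2 (C := C * R)
      (ae_of_all _ fun y x => hb _ _ (norm_posteriorMean_le hP r x))]
  refine integral_congr_ae (ae_of_all _ fun x => ?_)
  simp only
  rw [integral_smul_const]
  change _ = partitionFn P r x • _
  rw [← map_smul, partitionFn_smul_posteriorMean, posteriorMoment,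
    ← ContinuousLinearMap.integral_comp_comm _ (integrable_shiftDensity_smul hP r x)]
  simp_rw [map_smul]

/-- The law of `r y + z`, `y ∼ P`, `z ∼ N(0, I)`. -/
def noisyLaw (P : Measure E) (r : ℝ) : Measure E :=
  (P.prod (stdGaussian E)).map (fun p => r • p.1 + p.2)

theorem measurable_smul_add (r : ℝ) : Measurable (fun p : E × E => r • p.1 + p.2) := by fun_prop

instance (r : ℝ) : IsProbabilityMeasure (noisyLaw P r) :=
  Measure.isProbabilityMeasure_map (measurable_smul_add r).aemeasurable

/-- Needed so that the exceptional null set in Rademacher's theorem is also null for the law of `r y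
+ z`. -/
theorem noisyLaw_absolutelyContinuous (r : ℝ) : noisyLaw P r ≪ volume := by
  have h1 : noisyLaw P r =
      ((P.prod (stdGaussian E)).map (fun p => (p.1, r • p.1 + p.2))).map Prod.snd := by
    rw [Measure.map_map measurable_snd (by fun_prop)]
    rfl
  rw [h1, map_prod_stdGaussian]
  refine Measure.AbsolutelyContinuous.trans
    ((withDensity_absolutelyContinuous _ _).map measurable_snd) ?_
  rw [Measure.map_snd_prod]
  simpa using stdGaussian_absolutelyContinuous

/-- Test functions that are transported along the flow have constant expectation. -/
theorem integral_comp_odeFlow_posteriorMean (hP : ∀ᵐ y ∂P, ‖y‖ ≤ R) [FiniteDimensional ℝ F]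
    {ψ : E → F} {C : ℝ≥0} (hψ : LipschitzWith C ψ) {B : ℝ} (hB : ∀ x, ‖ψ x‖ ≤ B) (r₁ a b : ℝ) :
    ∫ p, ψ (odeFlow (posteriorMean P) a (a • p.1 + p.2) r₁) ∂(P.prod (stdGaussian E)) =
      ∫ p, ψ (odeFlow (posteriorMean P) b (b • p.1 + p.2) r₁) ∂(P.prod (stdGaussian E)) := by
  have hv := isBoundedField_posteriorMean hP
  set Ψ := odeFlow (posteriorMean P) with hΨ
  have hderiv : ∀ r, HasDerivAt
      (fun r => ∫ p, ψ (Ψ r (r • p.1 + p.2) r₁) ∂(P.prod (stdGaussian E))) 0 r := by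
    intro r
    obtain ⟨C', hC'⟩ := hv.exists_lipschitzWith_odeFlow r r₁
    set ψ₀ : E → F := fun x => ψ (Ψ r x r₁) with hψ₀
    have hL : LipschitzWith (C * C') ψ₀ := hψ.comp hC'
    -- By the group law the transport to `r₁` factors through time `r`, so the derivative at `r`
    -- only involves the flow near its starting time and the fixed Lipschitz function `ψ₀`.
    have hcongr : (fun s => ∫ p, ψ (Ψ s (s • p.1 + p.2) r₁) ∂(P.prod (stdGaussian E))) =
        fun s => ∫ p, ψ₀ (Ψ s (s • p.1 + p.2) r) ∂(P.prod (stdGaussian E)) := by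
      funext s
      simp only [hψ₀, hΨ, hv.odeFlow_odeFlow]
    rw [hcongr]
    have hmeas : ∀ s, AEStronglyMeasurable (fun p : E × E => ψ₀ (Ψ s (s • p.1 + p.2) r))
        (P.prod (stdGaussian E)) := fun s => by
      refine Continuous.aestronglyMeasurable ?_
      exact hL.continuous.comp ((hv.continuous_odeFlow_space s r).comp (by fun_prop))
    have hdiff : ∀ᵐ p ∂(P.prod (stdGaussian E)), DifferentiableAt ℝ ψ₀ (r • p.1 + p.2) := by
      have h := (noisyLaw_absolutelyContinuous (P := P) r).ae_le
        (hL.ae_differentiableAt (μ := volume))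
      exact ae_of_ae_map (measurable_smul_add r).aemeasurable h
    have hD : StronglyMeasurable (fderiv ℝ ψ₀) := by
      borelize (E →L[ℝ] F)
      exact (measurable_fderiv ℝ ψ₀).stronglyMeasurable
    have hDb : ∀ x, ‖fderiv ℝ ψ₀ x‖ ≤ (C * C' : ℝ≥0) := fun x => norm_fderiv_le_of_lipschitz ℝ hL
    have hG : StronglyMeasurable (fun p : E × E => fderiv ℝ ψ₀ (r • p.1 + p.2)) :=
      hD.comp_measurable (measurable_smul_add r)
    have hm1 : StronglyMeasurable (fun p : E × E => fderiv ℝ ψ₀ (r • p.1 + p.2) p.1) :=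
      stronglyMeasurable_clm_apply hG measurable_fst.stronglyMeasurable
    have hm2 : StronglyMeasurable (fun p : E × E =>
        fderiv ℝ ψ₀ (r • p.1 + p.2) (posteriorMean P r (r • p.1 + p.2))) :=
      stronglyMeasurable_clm_apply hG
        ((measurable_posteriorMean hP r).comp (measurable_smul_add r)).stronglyMeasurable
    have hfst : ∀ᵐ p ∂(P.prod (stdGaussian E)), ‖p.1‖ ≤ R :=
      Measure.quasiMeasurePreserving_fst.ae hP
    have key := hasDerivAt_integral_of_dominated_of_norm_sub_le (μ := P.prod (stdGaussian E))
      (f := fun s (p : E × E) => ψ₀ (Ψ s (s • p.1 + p.2) r))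
      (f' := fun p => fderiv ℝ ψ₀ (r • p.1 + p.2) (p.1 - posteriorMean P r (r • p.1 + p.2)))
      (bound := fun _ => (C * C' : ℝ≥0) * (2 * R)) (x₀ := r)
      hmeas ?_ ?_ ?_ (integrable_const _) ?_
    -- The derivative is the mean of `Dψ₀(r y + z)(y - m)`, and the tower property makes it zero.
    · convert! key using 1
      simp_rw [map_sub]
      rw [integral_sub, integral_apply_posteriorMean hP r hD hDb, sub_self]
      · refine Integrable.of_bound hm1.aestronglyMeasurable ((C * C' : ℝ≥0) * R) ?_
        filter_upwards [hfst] with p hp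
        exact (ContinuousLinearMap.le_opNorm _ _).trans (by gcongr; exact hDb _)
      · refine Integrable.of_bound hm2.aestronglyMeasurable ((C * C' : ℝ≥0) * R)
          (ae_of_all _ fun p => ?_)
        refine (ContinuousLinearMap.le_opNorm _ _).trans ?_
        gcongr
        · exact hDb _
        · exact norm_posteriorMean_le hP _ _
    · exact Integrable.of_bound (hmeas r) B (ae_of_all _ fun p => hB _)
    · simp_rw [map_sub]
      exact (hm1.sub hm2).aestronglyMeasurable
    · filter_upwards [hfst] with p hp s
      refine (hL.norm_sub_le _ _).trans ?_
      rw [mul_assoc]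
      gcongr
      rw [hΨ, hv.odeFlow_self]
      refine (hv.norm_odeFlow_start_sub_le _ _ _ _).trans ?_
      rw [add_sub_add_right_eq_sub, ← sub_smul, norm_smul, Real.norm_eq_abs]
      nlinarith [abs_nonneg (s - r)]
    · filter_upwards [hdiff] with p hp
      have hc : HasDerivAt (fun s : ℝ => s • p.1 + p.2) p.1 r := by
        simpa using! ((hasDerivAt_id r).smul_const p.1).add_const p.2
      have h1 := hv.hasDerivAt_odeFlow_start hc
      have h2 : HasFDerivAt ψ₀ (fderiv ℝ ψ₀ (r • p.1 + p.2)) (Ψ r (r • p.1 + p.2) r) := by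
        rw [hΨ, hv.odeFlow_self]
        exact hp.hasFDerivAt
      exact HasFDerivAt.comp_hasDerivAt (f := fun s => Ψ s (s • p.1 + p.2) r) r h2 h1
  exact is_const_of_deriv_eq_zero (fun r => (hderiv r).differentiableAt)
    (fun r => (hderiv r).deriv) a b

/-- Characters `exp(i⟪x, ξ⟫)` are bounded and Lipschitz, so the constancy of expectations along the
flow identifies the characteristic functions. -/
theorem map_odeFlow_noisyLaw (hP : ∀ᵐ y ∂P, ‖y‖ ≤ R) (a b : ℝ) :
    (noisyLaw P a).map (fun x => odeFlow (posteriorMean P) a x b) = noisyLaw P b := by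
  have hv := isBoundedField_posteriorMean hP
  have hm := (hv.continuous_odeFlow_space a b).measurable
  have : IsProbabilityMeasure ((noisyLaw P a).map (fun x => odeFlow (posteriorMean P) a x b)) :=
    Measure.isProbabilityMeasure_map hm.aemeasurable
  refine Measure.ext_of_charFun (funext fun ξ => ?_)
  let ψ : E → ℂ := fun x => Complex.exp (⟪x, ξ⟫ * Complex.I)
  have hψc : Continuous ψ := by fun_prop
  have hψL : LipschitzWith ‖ξ‖₊ ψ := by
    refine LipschitzWith.of_dist_le_mul fun x y => ?_
    rw [dist_eq_norm, dist_eq_norm, coe_nnnorm]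
    have h1 : ψ x - ψ y = Complex.exp (⟪y, ξ⟫ * Complex.I) *
        (Complex.exp (Complex.I * ⟪x - y, ξ⟫) - 1) := by
      rw [mul_sub, ← Complex.exp_add, mul_one, inner_sub_left]
      simp only [ψ]
      congr 2
      push_cast
      ring
    rw [h1, norm_mul, Complex.norm_exp_ofReal_mul_I, one_mul]
    refine (Real.norm_exp_I_mul_ofReal_sub_one_le).trans ?_
    rw [Real.norm_eq_abs, mul_comm]
    exact abs_real_inner_le_norm _ _
  have key := integral_comp_odeFlow_posteriorMean hP hψL (B := 1)
    (fun x => (Complex.norm_exp_ofReal_mul_I _).le) b a b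
  rw [charFun_apply, charFun_apply, integral_map hm.aemeasurable hψc.aestronglyMeasurable,
    noisyLaw, noisyLaw, integral_map (f := fun x => ψ (odeFlow (posteriorMean P) a x b))
      (measurable_smul_add _).aemeasurable
      (hψc.measurable.comp hm).aestronglyMeasurable,
    integral_map (f := ψ) (measurable_smul_add _).aemeasurable hψc.aestronglyMeasurable]
  simpa only [hv.odeFlow_self] using key

end Transport

/-! ### The limit of the rescaled flow and its law. -/

section Origin

variable {E : Type*} [NormedAddCommGroup E] [InnerProductSpace ℝ E] [FiniteDimensional ℝ E]
  [MeasurableSpace E] [BorelSpace E] {P : Measure E} [IsProbabilityMeasure P] {R : ℝ≥0}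

/-- `r m(x) - x` is minus the conditional mean of `z` given `r y + z = x`, so this is conditional
Jensen. It is obtained by testing against the unit direction of that vector and applying the tower
property. -/
theorem lintegral_enorm_smul_posteriorMean_sub_le (hP : ∀ᵐ y ∂P, ‖y‖ ≤ R) (r : ℝ) :
    ∫⁻ x, ‖r • posteriorMean P r x - x‖ₑ ∂noisyLaw P r ≤ ∫⁻ z, ‖z‖ₑ ∂stdGaussian E := by
  set D : E → E := fun x => r • posteriorMean P r x - x with hD
  have hDm : Measurable D := ((measurable_posteriorMean hP r).const_smul r).sub measurable_id
  set U : E × E → E := fun p => r • p.1 + p.2 with hU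
  have hUm : Measurable U := measurable_smul_add r
  -- Pairing with the direction of `D x`; where `D x = 0` the inverse is zero and `G` vanishes,
  -- which does no harm.
  set G : E → E →L[ℝ] ℝ := fun x => innerSL ℝ (‖D x‖⁻¹ • D x) with hG
  have hGm : StronglyMeasurable G := by
    have h1 : Measurable (fun x => ‖D x‖⁻¹ • D x) := hDm.norm.inv.smul hDm
    exact (innerSL ℝ (E := E)).continuous.comp_stronglyMeasurable h1.stronglyMeasurable
  have hG1 : ∀ x, ‖G x‖ ≤ 1 := fun x => by
    rw [hG, innerSL_apply_norm, norm_smul, norm_inv, norm_norm]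
    exact inv_mul_le_one
  have hGD : ∀ x, G x (D x) = ‖D x‖ := fun x => by
    rw [hG, innerSL_apply_apply, real_inner_smul_left, real_inner_self_eq_norm_sq]
    by_cases h : ‖D x‖ = 0
    · simp [h]
    · field_simp
  have hGle : ∀ x v, |G x v| ≤ ‖v‖ := fun x v => by
    refine ((G x).le_opNorm v).trans ?_
    simpa using mul_le_mul_of_nonneg_right (hG1 x) (norm_nonneg v)
  have hz : Integrable (fun p : E × E => ‖p.2‖) (P.prod (stdGaussian E)) :=
    (IsGaussian.integrable_id (μ := stdGaussian E)).norm.comp_snd P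
  have hy : Integrable (fun p : E × E => ‖p.1‖) (P.prod (stdGaussian E)) :=
    Integrable.of_bound (by fun_prop) R (by
      filter_upwards [Measure.quasiMeasurePreserving_fst.ae hP] with p hp
      simpa using hp)
  have hint : ∀ v : E × E → E, Measurable v →
      (∀ᵐ p ∂(P.prod (stdGaussian E)), ‖v p‖ ≤ R ∨ ‖v p‖ ≤ ‖p.1‖ + ‖p.2‖) →
      Integrable (fun p => G (U p) (v p)) (P.prod (stdGaussian E)) := by
    intro v hv hle
    refine Integrable.mono' ((integrable_const (R : ℝ)).add (hy.add hz))
      (stronglyMeasurable_clm_apply (hGm.comp_measurable hUm)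
        hv.stronglyMeasurable).aestronglyMeasurable ?_
    filter_upwards [hle] with p hp
    refine (hGle _ _).trans ?_
    simp only [Pi.add_apply]
    have h1 := norm_nonneg p.1
    have h2 := norm_nonneg p.2
    rcases hp with hp | hp <;> linarith [NNReal.coe_nonneg R]
  have hIM := hint (fun p => posteriorMean P r (U p)) ((measurable_posteriorMean hP r).comp hUm)
    (ae_of_all _ fun p => Or.inl (norm_posteriorMean_le hP _ _))
  have hIy := hint (fun p => p.1) measurable_fst
    (ae_of_all _ fun p => Or.inr (by linarith [norm_nonneg p.2]))
  have hIz := hint (fun p => p.2) measurable_snd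
    (ae_of_all _ fun p => Or.inr (by linarith [norm_nonneg p.1]))
  have htower := integral_apply_posteriorMean hP r hGm hG1
  have hkey : ∀ p, ‖D (U p)‖ =
      r * G (U p) (posteriorMean P r (U p)) - (r * G (U p) p.1 + G (U p) p.2) := fun p => by
    rw [← hGD]
    simp only [hD, hU, map_sub, map_add, map_smul, smul_eq_mul]
  have hIyz : Integrable (fun p => r * G (U p) p.1 + G (U p) p.2) (P.prod (stdGaussian E)) :=
    (hIy.const_mul r).add hIz
  have hID : Integrable (fun p => ‖D (U p)‖) (P.prod (stdGaussian E)) := by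
    simp_rw [hkey]
    exact (hIM.const_mul r).sub hIyz
  have hfin : ∫ p, ‖D (U p)‖ ∂(P.prod (stdGaussian E)) ≤ ∫ p, ‖p.2‖ ∂(P.prod (stdGaussian E)) := by
    have : ∫ p, ‖D (U p)‖ ∂(P.prod (stdGaussian E)) =
        ∫ p, -G (U p) p.2 ∂(P.prod (stdGaussian E)) := by
      simp_rw [hkey]
      rw [integral_sub (hIM.const_mul r) hIyz, integral_add (hIy.const_mul r) hIz,
        integral_const_mul, integral_const_mul, htower, integral_neg]
      ring
    rw [this]
    exact integral_mono hIz.neg hz fun p => (neg_le_abs _).trans (hGle _ _)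
  rw [noisyLaw, lintegral_map hDm.enorm hUm]
  calc ∫⁻ p, ‖D (U p)‖ₑ ∂(P.prod (stdGaussian E))
      = ENNReal.ofReal (∫ p, ‖D (U p)‖ ∂(P.prod (stdGaussian E))) := by
        rw [ofReal_integral_eq_lintegral_ofReal hID (ae_of_all _ fun _ => norm_nonneg _)]
        simp_rw [ofReal_norm]
    _ ≤ ENNReal.ofReal (∫ p, ‖p.2‖ ∂(P.prod (stdGaussian E))) := ENNReal.ofReal_le_ofReal hfin
    _ = ∫⁻ p, ‖p.2‖ₑ ∂(P.prod (stdGaussian E)) := by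
        rw [ofReal_integral_eq_lintegral_ofReal hz (ae_of_all _ fun _ => norm_nonneg _)]
        simp_rw [ofReal_norm]
    _ = ∫⁻ z, ‖z‖ₑ ∂stdGaussian E := by
        rw [lintegral_prod _ (by fun_prop)]
        simp

/-- The point from which the trajectory through `u` at time `r` originates: the limit as `ρ → ∞`
of the rescaled flow. -/
def flowOrigin (P : Measure E) (r : ℝ) (u : E) : E :=
  limUnder atTop (fun ρ : ℝ => ρ⁻¹ • odeFlow (posteriorMean P) r u ρ)

theorem flowOrigin_odeFlow (hP : ∀ᵐ y ∂P, ‖y‖ ≤ R) (r s : ℝ) (u : E) :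
    flowOrigin P s (odeFlow (posteriorMean P) r u s) = flowOrigin P r u := by
  simp only [flowOrigin, (isBoundedField_posteriorMean hP).odeFlow_odeFlow]

theorem lintegral_inv_sq_Ioi_lt_top {r : ℝ} (hr : 0 < r) :
    ∫⁻ ρ in Ioi r, ‖ρ⁻¹ ^ 2‖ₑ < ∞ := by
  have h := (integrableOn_Ioi_rpow_of_lt (a := -2) (by norm_num) hr)
  have h2 : IntegrableOn (fun ρ : ℝ => ρ⁻¹ ^ 2) (Ioi r) := by
    refine h.congr_fun (fun ρ hρ => ?_) measurableSet_Ioi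
    have : (0 : ℝ) < ρ := hr.trans hρ
    simp only
    rw [Real.rpow_neg this.le, inv_pow]
    norm_cast
  exact h2.2

/-- The derivative of `ρ⁻¹ Ψ` is `ρ⁻² (ρ m - Ψ)`. The flow preserves the family of noisy laws, so
its mean norm is at most `ρ⁻² E‖z‖`, integrable at infinity; by Tonelli almost every curve has an
integrable derivative, hence a limit. -/
theorem ae_tendsto_flowOrigin (hP : ∀ᵐ y ∂P, ‖y‖ ≤ R) {r : ℝ} (hr : 0 < r) :
    ∀ᵐ u ∂noisyLaw P r, Tendsto (fun ρ : ℝ => ρ⁻¹ • odeFlow (posteriorMean P) r u ρ) atTop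
      (𝓝 (flowOrigin P r u)) := by
  have hv := isBoundedField_posteriorMean hP
  set Ψ := odeFlow (posteriorMean P) r with hΨ
  let W : E → ℝ → E := fun u ρ => ρ⁻¹ ^ 2 • (ρ • posteriorMean P ρ (Ψ u ρ) - Ψ u ρ)
  have hM : Continuous (fun p : E × ℝ => posteriorMean P p.2 (Ψ p.1 p.2)) :=
    hv.continuous.comp (continuous_snd.prodMk (hv.continuous_odeFlow r))
  have hWm : Measurable (fun p : E × ℝ => W p.1 p.2) := by
    refine Measurable.smul (by fun_prop) ?_
    exact ((continuous_snd.smul hM).sub (hv.continuous_odeFlow r)).measurable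
  have hfin : ∫⁻ u, (∫⁻ ρ in Ioi r, ‖W u ρ‖ₑ) ∂noisyLaw P r < ∞ := by
    rw [lintegral_lintegral_swap hWm.enorm.aemeasurable]
    calc ∫⁻ ρ in Ioi r, ∫⁻ u, ‖W u ρ‖ₑ ∂noisyLaw P r
        ≤ ∫⁻ ρ in Ioi r, ‖ρ⁻¹ ^ 2‖ₑ * ∫⁻ z, ‖z‖ₑ ∂stdGaussian E := by
          refine lintegral_mono fun ρ => ?_
          simp only [W, enorm_smul]
          have hΨm := (hv.continuous_odeFlow_space r ρ).measurable
          have hDm : Measurable (fun x => ρ • posteriorMean P ρ x - x) :=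
            ((measurable_posteriorMean hP ρ).const_smul ρ).sub measurable_id
          have hDΨ : Measurable fun u => ‖ρ • posteriorMean P ρ (Ψ u ρ) - Ψ u ρ‖ₑ :=
            (hDm.comp hΨm).enorm
          rw [lintegral_const_mul _ hDΨ]
          refine mul_le_mul_right ?_ _
          rw [← lintegral_map (f := fun x => ‖ρ • posteriorMean P ρ x - x‖ₑ)
            (g := fun u => Ψ u ρ) hDm.enorm hΨm, hΨ, map_odeFlow_noisyLaw hP]
          exact lintegral_enorm_smul_posteriorMean_sub_le hP ρ
      _ < ∞ := by
          rw [lintegral_mul_const _ (by fun_prop)]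
          exact ENNReal.mul_lt_top (lintegral_inv_sq_Ioi_lt_top hr)
            (IsGaussian.integrable_id (μ := stdGaussian E)).2
  have hae := ae_lt_top (hWm.enorm.lintegral_prod_right' (ν := volume.restrict (Ioi r))) hfin.ne
  filter_upwards [hae] with u hu
  refine tendsto_limUnder_of_hasDerivAt_of_integrableOn_Ioi (a := r) (f' := W u) (fun ρ hρ => ?_)
    ⟨(hWm.comp measurable_prodMk_left).aestronglyMeasurable, hu⟩
  have hρ0 : ρ ≠ 0 := (hr.trans hρ).ne'
  have h := (hasDerivAt_inv hρ0).smul (hv.hasDerivAt_odeFlow r u ρ)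
  convert! h using 1
  simp only [W, smul_sub, smul_smul, neg_smul, ← sub_eq_add_neg]
  congr 2
  field_simp
  rw [inv_pow]

theorem aemeasurable_flowOrigin (hP : ∀ᵐ y ∂P, ‖y‖ ≤ R) {r : ℝ} (hr : 0 < r) :
    AEMeasurable (flowOrigin P r) (noisyLaw P r) := by
  refine aemeasurable_of_tendsto_metrizable_ae atTop (f := fun (ρ : ℝ) u =>
    ρ⁻¹ • odeFlow (posteriorMean P) r u ρ) (fun ρ => ?_) (ae_tendsto_flowOrigin hP hr)
  exact (((isBoundedField_posteriorMean hP).continuous_odeFlow_space r ρ).measurable.const_smul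
    _).aemeasurable

/-- At `ρ = n` the rescaled flow has the law of `y + z / n`, which tends to `P`; dominated
convergence on both sides identifies the law of the limit. -/
theorem map_flowOrigin (hP : ∀ᵐ y ∂P, ‖y‖ ≤ R) {r : ℝ} (hr : 0 < r) :
    (noisyLaw P r).map (flowOrigin P r) = P := by
  have hv := isBoundedField_posteriorMean hP
  have hO := aemeasurable_flowOrigin hP hr
  have : IsProbabilityMeasure ((noisyLaw P r).map (flowOrigin P r)) :=
    Measure.isProbabilityMeasure_map hO
  refine ext_of_forall_integral_eq_of_IsFiniteMeasure fun φ => ?_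
  rw [integral_map hO φ.continuous.aestronglyMeasurable]
  have h1 : Tendsto (fun n : ℕ => ∫ u, φ ((n : ℝ)⁻¹ • odeFlow (posteriorMean P) r u n)
      ∂noisyLaw P r) atTop (𝓝 (∫ u, φ (flowOrigin P r u) ∂noisyLaw P r)) := by
    refine tendsto_integral_of_dominated_convergence (fun _ => ‖φ‖) (fun n => ?_)
      (integrable_const _) (fun n => ae_of_all _ fun u => φ.norm_coe_le_norm _) ?_
    · exact (φ.continuous.comp
        ((hv.continuous_odeFlow_space r n).const_smul _)).aestronglyMeasurable
    · filter_upwards [ae_tendsto_flowOrigin hP hr] with u hu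
      exact (φ.continuous.tendsto _).comp (hu.comp tendsto_natCast_atTop_atTop)
  have h2 : Tendsto (fun n : ℕ => ∫ p, φ ((n : ℝ)⁻¹ • ((n : ℝ) • p.1 + p.2))
      ∂(P.prod (stdGaussian E))) atTop (𝓝 (∫ p, φ p.1 ∂(P.prod (stdGaussian E)))) := by
    refine tendsto_integral_of_dominated_convergence (fun _ => ‖φ‖) (fun n => ?_)
      (integrable_const _) (fun n => ae_of_all _ fun u => φ.norm_coe_le_norm _)
      (ae_of_all _ fun p => ?_)
    · exact (φ.continuous.comp (by fun_prop)).aestronglyMeasurable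
    · refine (φ.continuous.tendsto _).comp ?_
      have h3 : Tendsto (fun n : ℕ => p.1 + (n : ℝ)⁻¹ • p.2) atTop (𝓝 p.1) := by
        have := (tendsto_inv_atTop_nhds_zero_nat (𝕜 := ℝ)).smul_const p.2
        simpa using this.const_add p.1
      refine h3.congr' ?_
      filter_upwards [eventually_ge_atTop 1] with n hn
      have : (n : ℝ) ≠ 0 := by positivity
      rw [smul_add, inv_smul_smul₀ this]
  have h4 : ∫ p, φ p.1 ∂(P.prod (stdGaussian E)) = ∫ y, φ y ∂P := by
    rw [integral_fun_fst]; simp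
  rw [h4] at h2
  refine tendsto_nhds_unique h1 (h2.congr fun n => ?_)
  have hc : Continuous fun x : E => φ ((n : ℝ)⁻¹ • x) := φ.continuous.comp (by fun_prop)
  have hm := (hv.continuous_odeFlow_space r n).measurable
  rw [← integral_map (f := fun x : E => φ ((n : ℝ)⁻¹ • x)) hm.aemeasurable
    hc.aestronglyMeasurable, map_odeFlow_noisyLaw hP, noisyLaw,
    integral_map (measurable_smul_add _).aemeasurable hc.aestronglyMeasurable]

end Origin

/-! ### From the flow in `(r, u)` back to the probability flow ODE. -/

section Trajectory

variable {d : ℕ} {T : ℝ} {h g α σ : ℝ → ℝ} {P : Measure (Vec d)} [IsProbabilityMeasure P] {R : ℝ≥0}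

theorem marginal_eq_map_noisyLaw {t : ℝ} (hσ : σ t ≠ 0) :
    marginal α σ P t = (noisyLaw P (α t / σ t)).map (fun u => σ t • u) := by
  rw [marginal, diffuse, noisyLaw, Measure.map_map (by fun_prop) (by fun_prop)]
  congr 1
  ext1 p
  simp only [Function.comp_apply, smul_add, smul_smul, mul_div_cancel₀ _ hσ]

theorem marginalDensity_eq (t : ℝ) (hσ : 0 < σ t) (x : Vec d) :
    marginalDensity α σ P t x = (2 * Real.pi * σ t ^ 2) ^ (-(d : ℝ) / 2) *
      Real.exp (-‖x‖ ^ 2 / (2 * σ t ^ 2)) * partitionFn P (α t / σ t) ((σ t)⁻¹ • x) := by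
  rw [marginalDensity, integral_const_mul, partitionFn, mul_assoc (_ ^ _)]
  congr 1
  rw [← integral_const_mul]
  refine integral_congr_ae (ae_of_all _ fun y => ?_)
  simp only
  rw [shiftDensity, ← Real.exp_add]
  congr 1
  rw [norm_sub_sq_real, real_inner_smul_left, real_inner_smul_right, real_inner_smul_right,
    norm_smul, norm_smul, mul_pow, mul_pow, Real.norm_eq_abs, Real.norm_eq_abs, sq_abs, sq_abs,
    real_inner_comm]
  field_simp
  ring

/-- Tweedie's formula: the marginal density is a Gaussian factor times the partition function at `x
/ σ`, and the two logarithms are differentiated separately. -/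
theorem score_eq (hP : ∀ᵐ y ∂P, ‖y‖ ≤ R) {t : ℝ} (hσ : 0 < σ t) (x : Vec d) :
    score α σ P t x =
      (-(σ t ^ 2)⁻¹) • x + (α t / σ t ^ 2) • posteriorMean P (α t / σ t) ((σ t)⁻¹ • x) := by
  refine HasGradientAt.gradient ?_
  have hlog : (fun z => Real.log (marginalDensity α σ P t z)) = fun z =>
      Real.log ((2 * Real.pi * σ t ^ 2) ^ (-(d : ℝ) / 2)) + (-(2 * σ t ^ 2)⁻¹) * ‖z‖ ^ 2 +
        Real.log (partitionFn P (α t / σ t) ((σ t)⁻¹ • z)) := by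
    ext z
    rw [marginalDensity_eq t hσ, Real.log_mul (by positivity) (partitionFn_pos _ _ _).ne',
      Real.log_mul (by positivity) (Real.exp_pos _).ne', Real.log_exp]
    ring
  rw [hlog, hasGradientAt_iff_hasFDerivAt]
  have h1 : HasFDerivAt (fun z : Vec d => ‖z‖ ^ 2) (2 • innerSL ℝ x) x :=
    (hasStrictFDerivAt_norm_sq x).hasFDerivAt
  have h2 := (hasGradientAt_log_partitionFn hP (α t / σ t) ((σ t)⁻¹ • x)).hasFDerivAt.comp x
    ((hasFDerivAt_id x).const_smul (σ t)⁻¹)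
  convert! ((h1.const_mul (-(2 * σ t ^ 2)⁻¹)).const_add
    (Real.log ((2 * Real.pi * σ t ^ 2) ^ (-(d : ℝ) / 2)))).add h2 using 1
  ext z
  simp only [InnerProductSpace.toDual_apply_apply, add_apply, smul_apply, innerSL_apply_apply,
    inner_add_left, real_inner_smul_left, ContinuousLinearMap.comp_apply,
    ContinuousLinearMap.id_apply, real_inner_smul_right, smul_eq_mul, nsmul_eq_mul]
  field_simp
  push_cast
  ring

theorem pfVelocity_eq (hP : ∀ᵐ y ∂P, ‖y‖ ≤ R) {t : ℝ} (hσ : 0 < σ t) (x : Vec d) :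
    pfVelocity h g α σ P t x = (h t + g t ^ 2 / (2 * σ t ^ 2)) • x -
      (g t ^ 2 * α t / (2 * σ t ^ 2)) • posteriorMean P (α t / σ t) ((σ t)⁻¹ • x) := by
  rw [pfVelocity, score_eq hP hσ, smul_add, smul_smul, smul_smul, add_smul]
  have h1 : (1 / 2 * g t ^ 2 * -(σ t ^ 2)⁻¹) = -(g t ^ 2 / (2 * σ t ^ 2)) := by field_simp
  have h2 : 1 / 2 * g t ^ 2 * (α t / σ t ^ 2) = g t ^ 2 * α t / (2 * σ t ^ 2) := by field_simp
  rw [h1, h2, neg_smul]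
  abel

namespace IsNoiseSchedule

variable (hs : IsNoiseSchedule T h g α σ)
include hs

theorem hasDerivWithinAt_α {t : ℝ} (ht : t ∈ Ioc 0 T) :
    HasDerivWithinAt α (h t * α t) (Icc 0 T) t := by
  have hpos : ∀ s ∈ Icc 0 T, Real.exp (Real.log (α s)) = α s := fun s hs' => by
    refine Real.exp_log ?_
    rcases hs'.1.eq_or_lt with rfl | h0
    · rw [hs.α_zero]; exact one_pos
    · exact hs.α_pos s ⟨h0, hs'.2⟩
  have := (hs.deriv_log_α t ht).exp
  rw [hpos t ⟨ht.1.le, ht.2⟩, mul_comm] at this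
  exact this.congr (fun s hs' => (hpos s hs').symm) (hpos t ⟨ht.1.le, ht.2⟩).symm

theorem hasDerivWithinAt_σ {t : ℝ} (ht : t ∈ Ioc 0 T) :
    HasDerivWithinAt σ ((h t + g t ^ 2 / (2 * σ t ^ 2)) * σ t) (Icc 0 T) t := by
  have hpos : ∀ s ∈ Icc 0 T, √(σ s ^ 2) = σ s := fun s hs' => by
    refine Real.sqrt_sq ?_
    rcases hs'.1.eq_or_lt with rfl | h0
    · rw [hs.σ_zero]
    · exact (hs.σ_pos s ⟨h0, hs'.2⟩).le
  have hσ := hs.σ_pos t ht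
  have := (hs.deriv_sq_σ t ht).sqrt (by positivity)
  rw [hpos t ⟨ht.1.le, ht.2⟩] at this
  convert! this.congr (fun s hs' => (hpos s hs').symm) (hpos t ⟨ht.1.le, ht.2⟩).symm using 1
  field_simp
  ring

theorem hasDerivWithinAt_ratio {t : ℝ} (ht : t ∈ Ioc 0 T) :
    HasDerivWithinAt (fun t => α t / σ t) (-(g t ^ 2 * α t / (2 * σ t ^ 3))) (Icc 0 T) t := by
  have hσ := hs.σ_pos t ht
  convert! (hs.hasDerivWithinAt_α ht).div (hs.hasDerivWithinAt_σ ht) hσ.ne' using 1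
  field_simp
  ring

/-- The flow in the variables `u = x / σ`, `r = α / σ` solves the probability flow ODE. -/
theorem hasDerivWithinAt_flow (hP : ∀ᵐ y ∂P, ‖y‖ ≤ R) (r₀ : ℝ) (u : Vec d) {t : ℝ}
    (ht : t ∈ Ioc 0 T) :
    HasDerivWithinAt (fun t => σ t • odeFlow (posteriorMean P) r₀ u (α t / σ t))
      (pfVelocity h g α σ P t (σ t • odeFlow (posteriorMean P) r₀ u (α t / σ t))) (Icc 0 T) t := by
  have hσ := hs.σ_pos t ht
  have h1 := ((isBoundedField_posteriorMean hP).hasDerivAt_odeFlow r₀ u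
    (α t / σ t)).scomp_hasDerivWithinAt t (hs.hasDerivWithinAt_ratio ht)
  have h2 := (hs.hasDerivWithinAt_σ ht).smul h1
  convert! h2 using 1
  rw [pfVelocity_eq hP hσ, inv_smul_smul₀ hσ.ne', smul_smul, smul_smul, add_comm (_ • posteriorMean P _ _),
    sub_eq_add_neg, ← neg_smul]
  congr 2
  field_simp

theorem tendsto_ratio (hT : 0 < T) :
    Tendsto (fun t => α t / σ t) (𝓝[Ioc 0 T] 0) atTop := by
  have h0 : (0 : ℝ) ∈ Icc 0 T := ⟨le_rfl, hT.le⟩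
  have h1 : Tendsto α (𝓝[Ioc 0 T] 0) (𝓝 1) := by
    have := (hs.continuousOn_α 0 h0).mono Ioc_subset_Icc_self
    rwa [ContinuousWithinAt, hs.α_zero] at this
  have h2 : Tendsto σ (𝓝[Ioc 0 T] 0) (𝓝[>] 0) := by
    refine tendsto_nhdsWithin_iff.2 ⟨?_, ?_⟩
    · have := (hs.continuousOn_σ 0 h0).mono Ioc_subset_Icc_self
      rwa [ContinuousWithinAt, hs.σ_zero] at this
    · filter_upwards [self_mem_nhdsWithin] with t ht using hs.σ_pos t ht
  simp_rw [div_eq_mul_inv]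
  exact h1.pos_mul_atTop one_pos (tendsto_inv_nhdsGT_zero.comp h2)

/-- Write `σ = α · (α / σ)⁻¹`: as `t ↓ 0`, `α → 1` and the ratio tends to infinity, which gives the
rescaled limit. -/
theorem tendsto_flow {r₀ : ℝ} {u o : Vec d} (hT : 0 < T)
    (ho : Tendsto (fun ρ : ℝ => ρ⁻¹ • odeFlow (posteriorMean P) r₀ u ρ) atTop (𝓝 o)) :
    Tendsto (fun t => σ t • odeFlow (posteriorMean P) r₀ u (α t / σ t)) (𝓝[Ioc 0 T] 0) (𝓝 o) := by
  have h0 : (0 : ℝ) ∈ Icc 0 T := ⟨le_rfl, hT.le⟩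
  have h1 : Tendsto α (𝓝[Ioc 0 T] 0) (𝓝 1) := by
    have := (hs.continuousOn_α 0 h0).mono Ioc_subset_Icc_self
    rwa [ContinuousWithinAt, hs.α_zero] at this
  have h2 := h1.smul (ho.comp (hs.tendsto_ratio hT))
  rw [one_smul] at h2
  refine h2.congr' ?_
  filter_upwards [self_mem_nhdsWithin] with t ht
  have hσ := hs.σ_pos t ht
  have hα := hs.α_pos t ht
  simp only [Function.comp_apply, smul_smul]
  congr 1
  field_simp

theorem exists_isTrajectory (hP : ∀ᵐ y ∂P, ‖y‖ ≤ R) {t₀ : ℝ} (ht₀ : t₀ ∈ Ioc 0 T) {u o : Vec d}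
    (ho : Tendsto (fun ρ : ℝ => ρ⁻¹ • odeFlow (posteriorMean P) (α t₀ / σ t₀) u ρ) atTop (𝓝 o)) :
    ∃ y, IsTrajectory (pfVelocity h g α σ P) T t₀ (σ t₀ • u) y := by
  have hT : 0 < T := ht₀.1.trans_le ht₀.2
  set w : ℝ → Vec d := fun t => σ t • odeFlow (posteriorMean P) (α t₀ / σ t₀) u (α t / σ t) with hw
  -- At `t = 0` the formula for `w` gives `σ 0 • _ = 0`, so the value there is replaced by the limit
  -- `o` to obtain continuity on `[0, T]`.
  have hy : ∀ t, t ≠ 0 → Function.update w 0 o t = w t := fun t ht =>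
    Function.update_of_ne ht _ _
  have hode : ∀ t ∈ Ioc 0 T, HasDerivWithinAt (Function.update w 0 o)
      (pfVelocity h g α σ P t (Function.update w 0 o t)) (Icc 0 T) t := by
    intro t ht
    rw [hy t ht.1.ne']
    refine (hs.hasDerivWithinAt_flow hP _ u ht).congr_of_eventuallyEq ?_ (hy t ht.1.ne')
    filter_upwards [mem_nhdsWithin_of_mem_nhds (lt_mem_nhds ht.1)] with s h0
    exact hy s h0.ne'
  refine ⟨Function.update w 0 o, ?_, ?_, hode⟩
  · rw [hy t₀ ht₀.1.ne', hw]
    simp only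
    rw [(isBoundedField_posteriorMean hP).odeFlow_self]
  · intro t ht
    rcases ht.1.eq_or_lt with rfl | h0
    · rw [continuousWithinAt_update_same, Icc_sdiff_left]
      exact hs.tendsto_flow hT ho
    · exact (hode t ⟨h0, ht.2⟩).continuousWithinAt

/-- The Lipschitz constant is a continuous function of `t` on `(0, T]`, hence bounded on `[a, b]`;
it may blow up at zero, so uniqueness is only argued away from zero. -/
theorem exists_lipschitzWith_pfVelocity (hP : ∀ᵐ y ∂P, ‖y‖ ≤ R) {a b : ℝ} (ha : 0 < a)
    (hb : b ≤ T) : ∃ K : ℝ≥0, ∀ t ∈ Icc a b, LipschitzWith K (pfVelocity h g α σ P t) := by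
  have hsub : Icc a b ⊆ Ioc 0 T := fun t ht => ⟨ha.trans_le ht.1, ht.2.trans hb⟩
  have hsub' : Icc a b ⊆ Icc 0 T := hsub.trans Ioc_subset_Icc_self
  have hσ : ∀ t ∈ Icc a b, 0 < σ t := fun t ht => hs.σ_pos t (hsub ht)
  have hα : ∀ t ∈ Icc a b, 0 < α t := fun t ht => hs.α_pos t (hsub ht)
  have hc : ContinuousOn (fun t => |h t + g t ^ 2 / (2 * σ t ^ 2)| +
      g t ^ 2 * α t / (2 * σ t ^ 2) * ((4 * R ^ 2 : ℝ≥0) * (α t / σ t) * (σ t)⁻¹)) (Icc a b) := by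
    have c1 := hs.continuousOn_h.mono hsub
    have c2 := hs.continuousOn_g.mono hsub
    have c3 := hs.continuousOn_α.mono hsub'
    have c4 := hs.continuousOn_σ.mono hsub'
    have n1 : ∀ t ∈ Icc a b, 2 * σ t ^ 2 ≠ 0 := fun t ht => by have := hσ t ht; positivity
    have n2 : ∀ t ∈ Icc a b, σ t ≠ 0 := fun t ht => (hσ t ht).ne'
    have c5 : ContinuousOn (fun t => 2 * σ t ^ 2) (Icc a b) := by fun_prop
    exact (c1.add ((c2.pow 2).div c5 n1)).abs.add ((((c2.pow 2).mul c3).div c5 n1).mul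
      ((continuousOn_const.mul (c3.div c4 n2)).mul (c4.inv₀ n2)))
  obtain ⟨K, hK⟩ := isCompact_Icc.bddAbove_image hc
  refine ⟨K.toNNReal, fun t ht => LipschitzWith.of_dist_le_mul fun x y => ?_⟩
  have hσt := hσ t ht
  have hαt := hα t ht
  have hKt := hK (mem_image_of_mem _ ht)
  have hLip := norm_posteriorMean_sub_le hP (α t / σ t) ((σ t)⁻¹ • x) ((σ t)⁻¹ • y)
  rw [← smul_sub, norm_smul, norm_inv, Real.norm_of_nonneg hσt.le,
    abs_of_pos (div_pos hαt hσt)] at hLip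
  rw [dist_eq_norm, dist_eq_norm, pfVelocity_eq hP hσt, pfVelocity_eq hP hσt, sub_sub_sub_comm,
    ← smul_sub, ← smul_sub]
  calc _ ≤ |h t + g t ^ 2 / (2 * σ t ^ 2)| * ‖x - y‖ + g t ^ 2 * α t / (2 * σ t ^ 2) *
        ((4 * R ^ 2 : ℝ≥0) * (α t / σ t) * ((σ t)⁻¹ * ‖x - y‖)) := by
        refine (norm_sub_le _ _).trans ?_
        rw [norm_smul, norm_smul, Real.norm_eq_abs, Real.norm_of_nonneg
          (show 0 ≤ g t ^ 2 * α t / (2 * σ t ^ 2) by positivity)]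
        gcongr
    _ = (|h t + g t ^ 2 / (2 * σ t ^ 2)| + g t ^ 2 * α t / (2 * σ t ^ 2) *
        ((4 * R ^ 2 : ℝ≥0) * (α t / σ t) * (σ t)⁻¹)) * ‖x - y‖ := by ring
    _ ≤ K.toNNReal * ‖x - y‖ := by
        gcongr
        exact hKt.trans (Real.le_coe_toNNReal K)

theorem isTrajectory_eq (hP : ∀ᵐ y ∂P, ‖y‖ ≤ R) {t₀ : ℝ} (ht₀ : t₀ ∈ Ioc 0 T) {u : Vec d}
    {y : ℝ → Vec d} (hy : IsTrajectory (pfVelocity h g α σ P) T t₀ (σ t₀ • u) y) {t : ℝ}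
    (ht : t ∈ Ioc 0 T) : y t = σ t • odeFlow (posteriorMean P) (α t₀ / σ t₀) u (α t / σ t) := by
  set w : ℝ → Vec d := fun t => σ t • odeFlow (posteriorMean P) (α t₀ / σ t₀) u (α t / σ t) with hw
  have hw0 : w t₀ = σ t₀ • u := by
    rw [hw]; simp only; rw [(isBoundedField_posteriorMean hP).odeFlow_self]
  have hwd : ∀ s ∈ Ioc 0 T, HasDerivWithinAt w (pfVelocity h g α σ P s (w s)) (Icc 0 T) s :=
    fun s hs' => hs.hasDerivWithinAt_flow hP _ u hs'
  have hwc : ContinuousOn w (Ioc 0 T) := fun s hs' =>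
    (hwd s hs').continuousWithinAt.mono Ioc_subset_Icc_self
  rcases le_total t₀ t with hle | hle
  · obtain ⟨K, hK⟩ := hs.exists_lipschitzWith_pfVelocity hP ht₀.1 ht.2
    have hsub : Icc t₀ t ⊆ Ioc 0 T := fun s hs' => ⟨ht₀.1.trans_le hs'.1, hs'.2.trans ht.2⟩
    have hnhds : ∀ s ∈ Ico t₀ t, Icc 0 T ∈ 𝓝[≥] s := fun s hs' =>
      mem_of_superset (Icc_mem_nhdsGE (hs'.2.trans_le ht.2))
        (Icc_subset_Icc_left (ht₀.1.le.trans hs'.1))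
    exact ODE_solution_unique_of_mem_Icc_right (v := pfVelocity h g α σ P) (K := K)
      (s := fun _ => univ) (fun s hs' => (hK s ⟨hs'.1, hs'.2.le⟩).lipschitzOnWith)
      (hy.continuousOn.mono (hsub.trans Ioc_subset_Icc_self))
      (fun s hs' => (hy.ode s (hsub ⟨hs'.1, hs'.2.le⟩)).mono_of_mem_nhdsWithin (hnhds s hs'))
      (fun _ _ => mem_univ _) (hwc.mono hsub)
      (fun s hs' => (hwd s (hsub ⟨hs'.1, hs'.2.le⟩)).mono_of_mem_nhdsWithin (hnhds s hs'))
      (fun _ _ => mem_univ _) (hy.initial.trans hw0.symm) ⟨hle, le_rfl⟩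
  · obtain ⟨K, hK⟩ := hs.exists_lipschitzWith_pfVelocity hP ht.1 ht₀.2
    have hsub : Icc t t₀ ⊆ Ioc 0 T := fun s hs' => ⟨ht.1.trans_le hs'.1, hs'.2.trans ht₀.2⟩
    have hnhds : ∀ s ∈ Ioc t t₀, Icc 0 T ∈ 𝓝[≤] s := fun s hs' =>
      mem_of_superset (Icc_mem_nhdsLE (ht.1.trans hs'.1)) (Icc_subset_Icc_right (hs'.2.trans ht₀.2))
    exact ODE_solution_unique_of_mem_Icc_left (v := pfVelocity h g α σ P) (K := K)
      (s := fun _ => univ) (fun s hs' => (hK s ⟨hs'.1.le, hs'.2⟩).lipschitzOnWith)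
      (hy.continuousOn.mono (hsub.trans Ioc_subset_Icc_self))
      (fun s hs' => (hy.ode s (hsub ⟨hs'.1.le, hs'.2⟩)).mono_of_mem_nhdsWithin (hnhds s hs'))
      (fun _ _ => mem_univ _) (hwc.mono hsub)
      (fun s hs' => (hwd s (hsub ⟨hs'.1.le, hs'.2⟩)).mono_of_mem_nhdsWithin (hnhds s hs'))
      (fun _ _ => mem_univ _) (hy.initial.trans hw0.symm) ⟨le_rfl, hle⟩

theorem ratio_pos {t : ℝ} (ht : t ∈ Ioc 0 T) : 0 < α t / σ t :=
  div_pos (hs.α_pos t ht) (hs.σ_pos t ht)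

/-- Almost every trajectory of the probability flow ODE is given by the flow of the posterior
mean. -/
theorem ae_trajectory_eq (hP : ∀ᵐ y ∂P, ‖y‖ ≤ R) {t₀ : ℝ} (ht₀ : t₀ ∈ Ioc 0 T) :
    ∀ᵐ u ∂noisyLaw P (α t₀ / σ t₀),
      (∀ t ∈ Ioc 0 T, trajectory (pfVelocity h g α σ P) T t₀ (σ t₀ • u) t =
        σ t • odeFlow (posteriorMean P) (α t₀ / σ t₀) u (α t / σ t)) ∧
      trajectory (pfVelocity h g α σ P) T t₀ (σ t₀ • u) 0 = flowOrigin P (α t₀ / σ t₀) u := by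
  have hT : 0 < T := ht₀.1.trans_le ht₀.2
  filter_upwards [ae_tendsto_flowOrigin hP (hs.ratio_pos ht₀)] with u hu
  have htr := isTrajectory_trajectory (hs.exists_isTrajectory hP ht₀ hu)
  have heq := fun t (ht : t ∈ Ioc 0 T) => hs.isTrajectory_eq hP ht₀ htr ht
  refine ⟨heq, ?_⟩
  have h1 := hs.tendsto_flow hT hu
  have h2 : Tendsto (trajectory (pfVelocity h g α σ P) T t₀ (σ t₀ • u)) (𝓝[Ioc 0 T] 0)
      (𝓝 (trajectory (pfVelocity h g α σ P) T t₀ (σ t₀ • u) 0)) :=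
    (htr.continuousOn 0 ⟨le_rfl, hT.le⟩).mono Ioc_subset_Icc_self
  have : (𝓝[Ioc 0 T] (0 : ℝ)).NeBot := by
    rw [← mem_closure_iff_nhdsWithin_neBot, closure_Ioc hT.ne]
    exact ⟨le_rfl, hT.le⟩
  -- Uniqueness identifies the trajectory for positive times; its value at zero is then forced by
  -- continuity.
  refine tendsto_nhds_unique h2 (h1.congr' ?_)
  filter_upwards [self_mem_nhdsWithin] with t ht using (heq t ht).symm

end IsNoiseSchedule

end Trajectory

/-! ### Relative entropy bounds in variational form, and Pinsker's inequality. -/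

section KL

variable {Ω Ω' : Type*} [MeasurableSpace Ω] [MeasurableSpace Ω']

/-- The Kullback-Leibler divergence of `A` from `B` is at most `C`, in the Donsker-Varadhan
variational form. -/
def KLBound (A B : Measure Ω) (C : ℝ) : Prop :=
  ∀ φ : Ω → ℝ, Measurable φ → ∀ K : ℝ, (∀ x, |φ x| ≤ K) →
    ∫ x, φ x ∂A ≤ Real.log (∫ x, Real.exp (φ x) ∂B) + C

theorem integrable_of_abs_le (A : Measure Ω) [IsFiniteMeasure A] {φ : Ω → ℝ} (hφ : Measurable φ)
    {K : ℝ} (hK : ∀ x, |φ x| ≤ K) : Integrable φ A :=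
  Integrable.of_bound hφ.aestronglyMeasurable K (ae_of_all _ hK)

theorem integrable_exp_of_abs_le (A : Measure Ω) [IsFiniteMeasure A] {φ : Ω → ℝ}
    (hφ : Measurable φ) {K : ℝ} (hK : ∀ x, |φ x| ≤ K) : Integrable (fun x => Real.exp (φ x)) A :=
  Integrable.of_bound hφ.exp.aestronglyMeasurable (Real.exp K) (ae_of_all _ fun x => by
    rw [Real.norm_of_nonneg (Real.exp_pos _).le]
    exact Real.exp_le_exp.2 ((le_abs_self _).trans (hK x)))

theorem integral_le_log_integral_exp (A : Measure Ω) [IsProbabilityMeasure A] {φ : Ω → ℝ}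
    (hφ : Integrable φ A) (hexp : Integrable (fun x => Real.exp (φ x)) A) :
    ∫ x, φ x ∂A ≤ Real.log (∫ x, Real.exp (φ x) ∂A) := by
  rw [Real.le_log_iff_exp_le (integral_exp_pos hexp)]
  exact convexOn_exp.map_integral_le Real.continuous_exp.continuousOn isClosed_univ
    (ae_of_all _ fun _ => mem_univ _) hφ hexp

theorem KLBound.refl (A : Measure Ω) [IsProbabilityMeasure A] : KLBound A A 0 := by
  intro φ hφ K hK
  rw [add_zero]
  exact integral_le_log_integral_exp A (integrable_of_abs_le A hφ hK)
    (integrable_exp_of_abs_le A hφ hK)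

theorem KLBound.mono {A B : Measure Ω} {C C' : ℝ} (h : KLBound A B C) (hC : C ≤ C') :
    KLBound A B C' := fun φ hφ K hK => (h φ hφ K hK).trans (by linarith)

/-- Pinsker's inequality. -/
theorem KLBound.measureReal_sub_le {A B : Measure Ω} [IsProbabilityMeasure A]
    [IsProbabilityMeasure B] {C : ℝ} (h : KLBound A B C) {s : Set Ω} (hs : MeasurableSet s) :
    A.real s - B.real s ≤ √(C / 2) := by
  by_cases hδ : A.real s - B.real s ≤ 0
  · exact hδ.trans (Real.sqrt_nonneg _)
  rw [not_le] at hδ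
  refine Real.le_sqrt_of_sq_le ?_
  set δ := A.real s - B.real s with hδ'
  set X : Ω → ℝ := s.indicator 1 with hX
  have hXm : Measurable X := measurable_one.indicator hs
  have hX01 : ∀ x, X x ∈ Icc (0 : ℝ) 1 := fun x => by
    by_cases hx : x ∈ s <;> simp [hX, hx]
  have hXB : ∫ x, X x ∂B = B.real s := by rw [hX, integral_indicator_one hs]
  have hXA : ∫ x, X x ∂A = A.real s := by rw [hX, integral_indicator_one hs]
  -- The multiplier `4δ` is optimal: Hoeffding's lemma bounds the log-moment by `4δ B(s) + 2δ²`, so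
  -- `4δ² ≤ 2δ² + C`.
  have h1 := h (fun x => 4 * δ * X x) (hXm.const_mul _) (4 * δ) (fun x => by
    rw [abs_of_nonneg (mul_nonneg (by positivity) (hX01 x).1)]
    exact mul_le_of_le_one_right (by positivity) (hX01 x).2)
  have h2 := (hasSubgaussianMGF_of_mem_Icc (μ := B) hXm.aemeasurable
    (ae_of_all _ hX01)).mgf_le (4 * δ)
  rw [hXB] at h2
  have h3 : Real.log (∫ x, Real.exp (4 * δ * X x) ∂B) ≤ 4 * δ * B.real s + 2 * δ ^ 2 := by
    have h4 : ∫ x, Real.exp (4 * δ * X x) ∂B =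
        Real.exp (4 * δ * B.real s) * mgf (fun x => X x - B.real s) B (4 * δ) := by
      rw [mgf, ← integral_const_mul]
      refine integral_congr_ae (ae_of_all _ fun x => ?_)
      simp only
      rw [← Real.exp_add]
      ring_nf
    have h5 : (((‖(1 : ℝ) - 0‖₊ / 2) ^ 2 : ℝ≥0) : ℝ) * (4 * δ) ^ 2 / 2 = 2 * δ ^ 2 := by
      simp
      ring
    rw [h5] at h2
    have h6 : ∫ x, Real.exp (4 * δ * X x) ∂B ≤ Real.exp (4 * δ * B.real s + 2 * δ ^ 2) := by
      rw [h4, Real.exp_add]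
      gcongr
    refine (Real.log_le_log ?_ h6).trans_eq (Real.log_exp _)
    exact integral_exp_pos (integrable_exp_of_abs_le B (hXm.const_mul _) (K := 4 * δ) fun x => by
      rw [abs_of_nonneg (mul_nonneg (by positivity) (hX01 x).1)]
      exact mul_le_of_le_one_right (by positivity) (hX01 x).2)
  rw [integral_const_mul, hXA] at h1
  have h7 : A.real s = δ + B.real s := by rw [hδ']; ring
  rw [h7] at h1
  nlinarith

end KL

/-! ### Maximal coupling of two probability measures. -/

section Coupling

variable {Ω : Type*} [MeasurableSpace Ω]

theorem inv_smul_prod_map_fst {A B : Measure Ω} [IsFiniteMeasure A] [IsFiniteMeasure B]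
    (h : A univ = B univ) :
    ((A univ)⁻¹ • A.prod B).map Prod.fst = A ∧ ((A univ)⁻¹ • A.prod B).map Prod.snd = B := by
  rw [Measure.map_smul, Measure.map_smul, Measure.map_fst_prod, Measure.map_snd_prod, ← h,
    smul_smul]
  by_cases h0 : A univ = 0
  · have hA : A = 0 := Measure.measure_univ_eq_zero.1 h0
    have hB : B = 0 := Measure.measure_univ_eq_zero.1 (h ▸ h0)
    simp [hA, hB]
  · rw [smul_smul, ENNReal.inv_mul_cancel h0 (measure_ne_top A _)]
    simp

/-- A coupling of two probability measures at total variation distance at most `δ` that is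
diagonal up to mass `δ`. -/
theorem exists_maximal_coupling {A B : Measure Ω} [IsProbabilityMeasure A]
    [IsProbabilityMeasure B] {δ : ℝ} (h : ∀ s, MeasurableSet s → A.real s - B.real s ≤ δ) :
    ∃ (m : Measure Ω) (ρ : Measure (Ω × Ω)), (m.map (fun x => (x, x)) + ρ).map Prod.fst = A ∧
      (m.map (fun x => (x, x)) + ρ).map Prod.snd = B ∧ ρ univ ≤ ENNReal.ofReal δ := by
  obtain ⟨s, hs, hBA, hAB⟩ := hahn_decomposition A B
  have h1 : B.restrict s ≤ A.restrict s := Measure.le_iff.2 fun t ht => by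
    rw [Measure.restrict_apply ht, Measure.restrict_apply ht]
    exact hBA _ (ht.inter hs) inter_subset_right
  have h2 : A.restrict sᶜ ≤ B.restrict sᶜ := Measure.le_iff.2 fun t ht => by
    rw [Measure.restrict_apply ht, Measure.restrict_apply ht]
    exact hAB _ (ht.inter hs.compl) inter_subset_right
  -- The minimum of `A` and `B`, by the Hahn decomposition. It is placed on the diagonal; the
  -- excesses `A'` and `B'` have equal mass and are coupled by their normalized product.
  set m := B.restrict s + A.restrict sᶜ with hm
  set A' := A.restrict s - B.restrict s with hA'
  set B' := B.restrict sᶜ - A.restrict sᶜ with hB'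
  have hA : m + A' = A := by
    rw [hm, hA', add_right_comm, add_comm (B.restrict s), Measure.sub_add_cancel_of_le h1,
      Measure.restrict_add_restrict_compl hs]
  have hB : m + B' = B := by
    rw [hm, hB', add_assoc, add_comm (A.restrict sᶜ), Measure.sub_add_cancel_of_le h2,
      Measure.restrict_add_restrict_compl hs]
  have hmt : m univ ≠ ∞ := measure_ne_top m _
  have hA'B' : A' univ = B' univ := by
    have e1 : m univ + A' univ = 1 := by
      rw [← Measure.add_apply, hA]; exact measure_univ
    have e2 : m univ + B' univ = 1 := by
      rw [← Measure.add_apply, hB]; exact measure_univ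
    exact (ENNReal.add_right_inj hmt).1 (e1.trans e2.symm)
  have hA'δ : A' univ ≤ ENNReal.ofReal δ := by
    have e : A' univ = ENNReal.ofReal (A.real s - B.real s) := by
      rw [hA', Measure.sub_apply MeasurableSet.univ h1, Measure.restrict_apply_univ,
        Measure.restrict_apply_univ, ENNReal.ofReal_sub _ measureReal_nonneg, ofReal_measureReal,
        ofReal_measureReal]
    rw [e]
    exact ENNReal.ofReal_le_ofReal (h s hs)
  obtain ⟨hf, hg⟩ := inv_smul_prod_map_fst hA'B'
  have hd : Measurable (fun x : Ω => (x, x)) := measurable_id.prodMk measurable_id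
  refine ⟨m, (A' univ)⁻¹ • A'.prod B', ?_, ?_, ?_⟩
  · rw [Measure.map_add _ _ measurable_fst, Measure.map_map measurable_fst hd, hf]
    simpa [Function.comp_def] using hA
  · rw [Measure.map_add _ _ measurable_snd, Measure.map_map measurable_snd hd, hg]
    simpa [Function.comp_def] using hB
  · refine le_of_eq_of_le ?_ hA'δ
    have e : ((A' univ)⁻¹ • A'.prod B') univ =
        (((A' univ)⁻¹ • A'.prod B').map Prod.fst) univ := by
      rw [Measure.map_apply measurable_fst MeasurableSet.univ, preimage_univ]
    rw [e, hf]

end Coupling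

/-! ### Relative entropy between Gaussians with different means. -/

section GaussianKL

variable {E : Type*} [NormedAddCommGroup E] [InnerProductSpace ℝ E] [FiniteDimensional ℝ E]
  [MeasurableSpace E] [BorelSpace E]

theorem integrable_shiftDensity_stdGaussian (c : E) :
    Integrable (shiftDensity c) (stdGaussian E) := by
  refine ⟨(measurable_shiftDensity c).aestronglyMeasurable, ?_⟩
  have h := lintegral_stdGaussian_add (fun _ => 1) measurable_const c
  simp only [mul_one, lintegral_const, measure_univ] at h
  rw [hasFiniteIntegral_iff_ofReal (ae_of_all _ fun z => (shiftDensity_pos c z).le), ← h]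
  exact ENNReal.one_lt_top

/-- Jensen applied to `ψ(z + c)` minus the log-density of `N(c, I)` evaluated at `z + c`. That
log-density is `⟪c, z⟫ + ‖c‖² / 2`, of mean `‖c‖² / 2`, and exponentiating its negative undoes the
translation. -/
theorem integral_stdGaussian_add_le {ψ : E → ℝ} (hψ : Measurable ψ) {K : ℝ}
    (hK : ∀ x, |ψ x| ≤ K) (c : E) :
    ∫ z, ψ (z + c) ∂stdGaussian E ≤
      Real.log (∫ z, Real.exp (ψ z) ∂stdGaussian E) + ‖c‖ ^ 2 / 2 := by
  have hψc : Measurable (fun z => ψ (z + c)) := hψ.comp (measurable_add_const c)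
  have hi1 : Integrable (fun z => ψ (z + c)) (stdGaussian E) :=
    integrable_of_abs_le _ hψc fun x => hK _
  have hi2 : Integrable (fun z => ⟪c, z⟫) (stdGaussian E) :=
    (IsGaussian.integrable_id (μ := stdGaussian E)).const_inner c
  have hzero : ∫ z, ⟪c, z⟫ ∂stdGaussian E = 0 := by
    have := integral_inner (𝕜 := ℝ) (IsGaussian.integrable_id (μ := stdGaussian E)) c
    simpa using this
  have hi3 : Integrable (fun z => ⟪c, z⟫ + ‖c‖ ^ 2 / 2) (stdGaussian E) :=
    hi2.add (integrable_const _)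
  have hshift : ∀ z, Real.exp (ψ (z + c) - (⟪c, z⟫ + ‖c‖ ^ 2 / 2)) =
      Real.exp (ψ (z + c)) * shiftDensity (-c) z := fun z => by
    rw [shiftDensity, ← Real.exp_add, inner_neg_left, norm_neg]
    ring_nf
  have hexp : Integrable (fun z => Real.exp (ψ (z + c) - (⟪c, z⟫ + ‖c‖ ^ 2 / 2)))
      (stdGaussian E) := by
    simp_rw [hshift]
    refine (integrable_shiftDensity_stdGaussian (-c)).bdd_mul (c := Real.exp K)
      hψc.exp.aestronglyMeasurable (ae_of_all _ fun z => ?_)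
    rw [Real.norm_of_nonneg (Real.exp_pos _).le]
    exact Real.exp_le_exp.2 ((le_abs_self _).trans (hK _))
  have hJ := integral_le_log_integral_exp (stdGaussian E) (hi1.sub hi3) hexp
  have hchange : ∫ z, Real.exp (ψ (z + c) - (⟪c, z⟫ + ‖c‖ ^ 2 / 2)) ∂stdGaussian E =
      ∫ z, Real.exp (ψ z) ∂stdGaussian E := by
    have hm : Measurable fun z : E => Real.exp (ψ z - (⟪c, z - c⟫ + ‖c‖ ^ 2 / 2)) := by
      fun_prop
    have := integral_stdGaussian_add (fun z => Real.exp (ψ z - (⟪c, z - c⟫ + ‖c‖ ^ 2 / 2)))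
      hm.stronglyMeasurable c
    simp only [add_sub_cancel_right] at this
    rw [this]
    refine integral_congr_ae (ae_of_all _ fun z => ?_)
    simp only [shiftDensity, smul_eq_mul]
    rw [← Real.exp_add, inner_sub_right, real_inner_self_eq_norm_sq]
    ring_nf
  simp only [Pi.sub_apply] at hJ
  rw [hchange, integral_sub hi1 hi3, integral_add hi2 (integrable_const _), hzero,
    integral_const, probReal_univ, one_smul] at hJ
  linarith

end GaussianKL

/-! ### Growth of relative entropy under one noising step. -/

section Diffuse

variable {d : ℕ}

theorem measurable_diffuse_map (a s : ℝ) :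
    Measurable (fun p : Vec d × Vec d => a • p.1 + s • p.2) := by fun_prop

instance isProbabilityMeasure_diffuse (a s : ℝ) (P : Measure (Vec d)) [IsProbabilityMeasure P] :
    IsProbabilityMeasure (diffuse a s P) :=
  Measure.isProbabilityMeasure_map (measurable_diffuse_map a s).aemeasurable

theorem integral_diffuse_map {A : Measure (Vec d)} [IsProbabilityMeasure A] {a : Vec d → Vec d}
    (ha : Measurable a) (r s : ℝ) {φ : Vec d → ℝ} (hφ : Measurable φ) {K : ℝ}
    (hK : ∀ x, |φ x| ≤ K) :
    ∫ x, φ x ∂diffuse r s (A.map a) = ∫ x, ∫ z, φ (r • a x + s • z) ∂stdGaussian (Vec d) ∂A := by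
  have : IsProbabilityMeasure (A.map a) := Measure.isProbabilityMeasure_map ha.aemeasurable
  have hm : Measurable (fun p : Vec d × Vec d => φ (r • p.1 + s • p.2)) :=
    hφ.comp (measurable_diffuse_map r s)
  rw [diffuse, integral_map (measurable_diffuse_map r s).aemeasurable hφ.aestronglyMeasurable,
    integral_prod _ (integrable_of_abs_le _ hm fun p => hK _),
    integral_map ha.aemeasurable hm.stronglyMeasurable.integral_prod_right'.aestronglyMeasurable]

/-- The chain rule for the Kullback-Leibler divergence of one noising step, and data
processing. -/
theorem KLBound.diffuse_map {A B : Measure (Vec d)} [IsProbabilityMeasure A]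
    [IsProbabilityMeasure B] {C : ℝ} (h : KLBound A B C) {a b : Vec d → Vec d} (ha : Measurable a)
    (hb : Measurable b) {D : ℝ} (hD0 : 0 ≤ D)
    (hD : ∫⁻ x, ‖a x - b x‖ₑ ^ 2 ∂A ≤ ENNReal.ofReal D) (r : ℝ) {s : ℝ} (hs : 0 < s) :
    KLBound (diffuse r s (A.map a)) (diffuse r s (B.map b)) (C + r ^ 2 / (2 * s ^ 2) * D) := by
  intro φ hφ K hK
  have hexpm : Measurable fun x => Real.exp (φ x) := hφ.exp
  have hexpK : ∀ x, |Real.exp (φ x)| ≤ Real.exp K := fun x => by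
    rw [abs_of_pos (Real.exp_pos _)]
    exact Real.exp_le_exp.2 ((le_abs_self _).trans (hK x))
  rw [integral_diffuse_map ha r s hφ hK, integral_diffuse_map hb r s hexpm hexpK]
  have hm : ∀ x, Measurable fun z : Vec d => φ (r • b x + s • z) := fun x =>
    hφ.comp (by fun_prop)
  -- `log Z` is the bounded test function to which the bound for `A` and `B` is applied; the inner
  -- Gaussian bound compares the noised `φ` with it pointwise.
  set Z : Vec d → ℝ := fun x => ∫ z, Real.exp (φ (r • b x + s • z)) ∂stdGaussian (Vec d) with hZ
  have hZi : ∀ x, Integrable (fun z => Real.exp (φ (r • b x + s • z))) (stdGaussian (Vec d)) :=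
    fun x => integrable_exp_of_abs_le _ (hm x) fun z => hK _
  have hZpos : ∀ x, 0 < Z x := fun x => integral_exp_pos (hZi x)
  have hZm : Measurable Z := by
    have : Measurable fun p : Vec d × Vec d => Real.exp (φ (r • b p.1 + s • p.2)) :=
      hexpm.comp (by fun_prop)
    exact this.stronglyMeasurable.integral_prod_right'.measurable
  have hZle : ∀ x, |Real.log (Z x)| ≤ K := fun x => by
    rw [abs_le]
    constructor
    · rw [Real.le_log_iff_exp_le (hZpos x)]
      have := integral_mono (integrable_const (Real.exp (-K))) (hZi x) fun z =>
        Real.exp_le_exp.2 (neg_le_of_abs_le (hK (r • b x + s • z)))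
      simpa using this
    · rw [Real.log_le_iff_le_exp (hZpos x)]
      have := integral_mono (hZi x) (integrable_const (Real.exp K)) fun z =>
        Real.exp_le_exp.2 (le_of_abs_le (hK (r • b x + s • z)))
      simpa using this
  have hab : Measurable fun x => ‖a x - b x‖ ^ 2 := by fun_prop
  have henorm : ∀ x, ENNReal.ofReal (‖a x - b x‖ ^ 2) = ‖a x - b x‖ₑ ^ 2 := fun x => by
    rw [ENNReal.ofReal_pow (norm_nonneg _), ofReal_norm]
  have habi : Integrable (fun x => ‖a x - b x‖ ^ 2) A := by
    refine ⟨hab.aestronglyMeasurable, ?_⟩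
    rw [hasFiniteIntegral_iff_ofReal (ae_of_all _ fun x => by positivity)]
    simp_rw [henorm]
    exact hD.trans_lt ENNReal.ofReal_lt_top
  have habD : ∫ x, ‖a x - b x‖ ^ 2 ∂A ≤ D := by
    rw [integral_eq_lintegral_of_nonneg_ae (ae_of_all _ fun x => by positivity)
      hab.aestronglyMeasurable]
    simp_rw [henorm]
    exact ENNReal.toReal_le_of_le_ofReal hD0 hD
  have hstep : ∀ x, ∫ z, φ (r • a x + s • z) ∂stdGaussian (Vec d) ≤
      Real.log (Z x) + r ^ 2 / (2 * s ^ 2) * ‖a x - b x‖ ^ 2 := fun x => by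
    -- In units of `s`, the means `r • a x` and `r • b x` differ by `(r / s) • (a x - b x)`.
    have := integral_stdGaussian_add_le (hm x) (fun z => hK _) ((r / s) • (a x - b x))
    have e : ∀ z, r • b x + s • (z + (r / s) • (a x - b x)) = r • a x + s • z := fun z => by
      rw [smul_add, smul_smul, mul_div_cancel₀ _ hs.ne', smul_sub]
      abel
    simp only [e] at this
    refine this.trans_eq ?_
    rw [norm_smul, mul_pow, Real.norm_eq_abs, sq_abs, div_pow]
    congr 1
    field_simp
  have hlogi : Integrable (fun x => Real.log (Z x)) A :=
    integrable_of_abs_le A hZm.log hZle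
  have hφm : Measurable fun p : Vec d × Vec d => φ (r • a p.1 + s • p.2) :=
    hφ.comp (by fun_prop)
  have hlhs : Integrable (fun x => ∫ z, φ (r • a x + s • z) ∂stdGaussian (Vec d)) A :=
    (integrable_of_abs_le (A.prod (stdGaussian (Vec d))) hφm fun p => hK _).integral_prod_left
  have h1 := integral_mono hlhs (hlogi.add (habi.const_mul (r ^ 2 / (2 * s ^ 2)))) hstep
  simp only [Pi.add_apply] at h1
  rw [integral_add hlogi (habi.const_mul _), integral_const_mul] at h1
  have h2 := h (fun x => Real.log (Z x)) hZm.log K hZle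
  simp only [Real.exp_log (hZpos _)] at h2
  have h3 : r ^ 2 / (2 * s ^ 2) * ∫ x, ‖a x - b x‖ ^ 2 ∂A ≤ r ^ 2 / (2 * s ^ 2) * D := by
    gcongr
  linarith

end Diffuse

/-! ### Conversions between squared integrals and `eLpNorm`. -/

section L2

variable {Ω E : Type*} [MeasurableSpace Ω] [NormedAddCommGroup E] {μ : Measure Ω}

theorem eLpNorm_two_sq (F : Ω → E) : eLpNorm F 2 μ ^ 2 = ∫⁻ x, ‖F x‖ₑ ^ 2 ∂μ := by
  rw [eLpNorm_eq_lintegral_rpow_enorm_toReal (by norm_num) (by norm_num), ← ENNReal.rpow_natCast,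
    ← ENNReal.rpow_mul]
  simp

theorem lintegral_rpow_half_eq_eLpNorm (F : Ω → E) :
    (∫⁻ x, ‖F x‖ₑ ^ 2 ∂μ) ^ (1 / 2 : ℝ) = eLpNorm F 2 μ := by
  rw [← eLpNorm_two_sq, ← ENNReal.rpow_natCast, ← ENNReal.rpow_mul]
  simp

theorem eLpNorm_two_le_iff (F : Ω → E) {c : ℝ} (hc : 0 ≤ c) :
    eLpNorm F 2 μ ≤ ENNReal.ofReal c ↔ ∫⁻ x, ‖F x‖ₑ ^ 2 ∂μ ≤ ENNReal.ofReal (c ^ 2) := by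
  rw [← eLpNorm_two_sq, ENNReal.ofReal_pow hc, ENNReal.pow_le_pow_left_iff two_ne_zero]

end L2

/-! ### Error of the consistency function, and its propagation through the sampler. -/

section ConsistencyError

variable {d : ℕ} {T : ℝ} {h g α σ : ℝ → ℝ} {P : Measure (Vec d)} [IsProbabilityMeasure P] {R : ℝ≥0}

/-- Scaling is a homeomorphism, so no measurability of `F` is needed. This matters because the
trajectories in the loss come from a choice and are not known to be measurable in `x`. -/
theorem lintegral_marginal {t : ℝ} (hσ : σ t ≠ 0) (F : Vec d → ℝ≥0∞) :
    ∫⁻ x, F x ∂marginal α σ P t = ∫⁻ u, F (σ t • u) ∂noisyLaw P (α t / σ t) := by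
  rw [marginal_eq_map_noisyLaw hσ]
  exact (Homeomorph.smulOfNeZero (σ t) hσ).measurableEmbedding.lintegral_map F

variable {M : ℕ} {Δ ε : ℝ} {f : Vec d → ℝ → Vec d}

/-- The `L²` distance of the consistency function from the origin of the trajectory grows at most
linearly along the training partition. -/
theorem eLpNorm_sub_flowOrigin_le (hs : IsNoiseSchedule T h g α σ) (hΔ : 0 < Δ) (hT : T = M * Δ)
    (hP : ∀ᵐ y ∂P, ‖y‖ ≤ R) (hf : ∀ t ∈ Ioc 0 T, Measurable fun x => f x t)
    (hf_zero : ∀ x, f x 0 = x) (hε : 0 < ε)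
    (hloss : ∀ i < M, consistencyLoss h g α σ P T Δ f i ≤ ENNReal.ofReal (ε ^ 2)) (k : ℕ)
    (hk1 : 1 ≤ k) (hkM : k ≤ M) :
    eLpNorm (fun u => f (σ (k * Δ) • u) (k * Δ) - flowOrigin P (α (k * Δ) / σ (k * Δ)) u) 2
      (noisyLaw P (α (k * Δ) / σ (k * Δ))) ≤ ENNReal.ofReal (k * ε) := by
  have hmem : ∀ k : ℕ, 1 ≤ k → k ≤ M → (k * Δ : ℝ) ∈ Ioc 0 T := fun k h1 h2 => by
    have h1' : (1 : ℝ) ≤ k := by exact_mod_cast h1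
    have h2' : (k : ℝ) ≤ M := by exact_mod_cast h2
    exact ⟨by positivity, by rw [hT]; gcongr⟩
  induction k, hk1 using Nat.le_induction with
  | base =>
    have ht := hmem 1 le_rfl hkM
    have hl := hloss 0 hkM
    rw [consistencyLoss, if_pos rfl] at hl
    simp only [Nat.cast_one, one_mul] at ht ⊢
    rw [lintegral_marginal (hs.σ_pos _ ht).ne'] at hl
    rw [eLpNorm_two_le_iff _ hε.le]
    refine le_of_eq_of_le (lintegral_congr_ae ?_) hl
    filter_upwards [hs.ae_trajectory_eq hP ht] with u hu
    rw [hu.2, hf_zero, ← enorm_neg, neg_sub]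
  | succ k hk ih =>
    have hkM' : k < M := hkM
    have ht := hmem k hk hkM'.le
    have ht' := hmem (k + 1) (hk.trans k.le_succ) hkM
    have hl := hloss k hkM'
    rw [consistencyLoss, if_neg (Nat.one_le_iff_ne_zero.1 hk),
      lintegral_marginal (hs.σ_pos _ ht).ne'] at hl
    have ih := ih hkM'.le
    have hcast : ((k + 1 : ℕ) : ℝ) = (k : ℝ) + 1 := by push_cast; ring
    rw [hcast] at ht' ⊢
    set t := (k : ℝ) * Δ with ht_def
    set t' := ((k : ℝ) + 1) * Δ with ht'_def
    set Φ : Vec d → Vec d := fun u => odeFlow (posteriorMean P) (α t / σ t) u (α t' / σ t') with hΦ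
    have hv := isBoundedField_posteriorMean hP
    have hΦm : Measurable Φ := (hv.continuous_odeFlow_space _ _).measurable
    have hft : Measurable fun u : Vec d => f (σ t • u) t := (hf t ht).comp (by fun_prop)
    have hft' : Measurable fun u : Vec d => f (σ t' • u) t' := (hf t' ht').comp (by fun_prop)
    have hO := aemeasurable_flowOrigin hP (hs.ratio_pos ht)
    have hO' := aemeasurable_flowOrigin hP (hs.ratio_pos ht')
    have hmap : (noisyLaw P (α t / σ t)).map Φ = noisyLaw P (α t' / σ t') :=
      map_odeFlow_noisyLaw hP _ _
    have hstep : eLpNorm (fun u => f (σ t' • Φ u) t' - f (σ t • u) t) 2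
        (noisyLaw P (α t / σ t)) ≤ ENNReal.ofReal ε := by
      rw [eLpNorm_two_le_iff _ hε.le]
      refine le_of_eq_of_le (lintegral_congr_ae ?_) hl
      filter_upwards [hs.ae_trajectory_eq hP ht] with u hu
      rw [hu.1 t' ht', ← enorm_neg, neg_sub]
    rw [← hmap, eLpNorm_map_measure (by
      rw [hmap]; exact (hft'.aemeasurable.sub hO').aestronglyMeasurable) hΦm.aemeasurable]
    -- Points on one flow line share their origin, so moving from `t` to `t'` adds only the loss of
    -- this step; the flow preserves the marginals, so the norms match.
    have hsplit : (fun u => f (σ t' • u) t' - flowOrigin P (α t' / σ t') u) ∘ Φ =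
        (fun u => f (σ t' • Φ u) t' - f (σ t • u) t) +
          fun u => f (σ t • u) t - flowOrigin P (α t / σ t) u := by
      ext1 u
      simp only [Function.comp_apply, Pi.add_apply, hΦ, flowOrigin_odeFlow hP]
      abel
    rw [hsplit, add_mul, one_mul, add_comm (_ * ε), ENNReal.ofReal_add hε.le (by positivity)]
    refine (eLpNorm_add_le ?_ ?_ (by norm_num)).trans (add_le_add hstep ih)
    · exact ((hft'.comp hΦm).sub hft).aestronglyMeasurable
    · exact (hft.aemeasurable.sub hO).aestronglyMeasurable

/-- At every time of the training partition there is a transport map to the data distribution that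
is close to the consistency function. -/
theorem exists_denoiser (hs : IsNoiseSchedule T h g α σ) (hΔ : 0 < Δ) (hT : T = M * Δ)
    (hP : ∀ᵐ y ∂P, ‖y‖ ≤ R) (hf : ∀ t ∈ Ioc 0 T, Measurable fun x => f x t)
    (hf_zero : ∀ x, f x 0 = x) (hε : 0 < ε)
    (hloss : ∀ i < M, consistencyLoss h g α σ P T Δ f i ≤ ENNReal.ofReal (ε ^ 2)) {k : ℕ}
    (hk1 : 1 ≤ k) (hkM : k ≤ M) :
    ∃ o : Vec d → Vec d, Measurable o ∧ (marginal α σ P (k * Δ)).map o = P ∧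
      eLpNorm (fun x => f x (k * Δ) - o x) 2 (marginal α σ P (k * Δ)) ≤
        ENNReal.ofReal (k * ε) := by
  have ht : (k * Δ : ℝ) ∈ Ioc 0 T := by
    have h1' : (1 : ℝ) ≤ k := by exact_mod_cast hk1
    have h2' : (k : ℝ) ≤ M := by exact_mod_cast hkM
    exact ⟨by positivity, by rw [hT]; gcongr⟩
  have hσ := (hs.σ_pos _ ht).ne'
  have hO := aemeasurable_flowOrigin hP (hs.ratio_pos ht)
  -- The origin is a limit existing only almost everywhere; a measurable modification is used.
  have hom : Measurable fun x : Vec d => hO.mk _ ((σ (k * Δ))⁻¹ • x) :=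
    hO.measurable_mk.comp (by fun_prop)
  refine ⟨_, hom, ?_, ?_⟩
  · rw [marginal_eq_map_noisyLaw hσ, Measure.map_map hom (by fun_prop)]
    simp only [Function.comp_def, inv_smul_smul₀ hσ]
    exact (Measure.map_congr hO.ae_eq_mk).symm.trans (map_flowOrigin hP (hs.ratio_pos ht))
  · rw [eLpNorm_two_le_iff _ (by positivity), lintegral_marginal hσ]
    refine le_of_eq_of_le (lintegral_congr_ae ?_) ((eLpNorm_two_le_iff _ (by positivity)).1
      (eLpNorm_sub_flowOrigin_le hs hΔ hT hP hf hf_zero hε hloss k hk1 hkM))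
    filter_upwards [hO.ae_eq_mk] with u hu
    rw [inv_smul_smul₀ hσ, ← hu]

instance (t : ℝ) : IsProbabilityMeasure (marginal α σ P t) :=
  isProbabilityMeasure_diffuse _ _ P

theorem isProbabilityMeasure_outputLaw (τ : ℕ → ℝ) {n : ℕ}
    (hf : ∀ j, 1 ≤ j → j ≤ n → Measurable fun x => f x (τ j)) :
    IsProbabilityMeasure (outputLaw α σ f τ n) := by
  induction n with
  | zero => exact Measure.dirac.isProbabilityMeasure
  | succ n ih =>
    have := ih fun j h1 h2 => hf j h1 (h2.trans n.le_succ)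
    exact Measure.isProbabilityMeasure_map (hf (n + 1) (by omega) le_rfl).aemeasurable

/-- Accumulation of the Kullback-Leibler divergence along the sampling schedule. -/
theorem klBound_diffuse_outputLaw (hP : ∀ᵐ y ∂P, ‖y‖ ≤ R) {N : ℕ} {τ : ℕ → ℝ} {e : ℝ}
    (hσ : ∀ j, 1 ≤ j → j ≤ N → 0 < σ (τ j))
    (hf : ∀ j, 1 ≤ j → j ≤ N → Measurable fun x => f x (τ j))
    (ho : ∀ j, 1 ≤ j → j ≤ N → 0 ≤ τ j * e ∧ ∃ o : Vec d → Vec d, Measurable o ∧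
      (marginal α σ P (τ j)).map o = P ∧
      eLpNorm (fun x => f x (τ j) - o x) 2 (marginal α σ P (τ j)) ≤ ENNReal.ofReal (τ j * e))
    {n : ℕ} (hn1 : 1 ≤ n) (hnN : n ≤ N) :
    KLBound (marginal α σ P (τ n)) (diffuse (α (τ n)) (σ (τ n)) (outputLaw α σ f τ (n - 1)))
      (2 * (α (τ 1) ^ 2 / (4 * σ (τ 1) ^ 2) * R ^ 2 + ∑ j ∈ Finset.Icc 2 n,
        α (τ j) ^ 2 / (4 * σ (τ j) ^ 2) * τ (j - 1) ^ 2 * e ^ 2)) := by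
  induction n, hn1 using Nat.le_induction with
  | base =>
    have hD : ∫⁻ x, ‖id x - (0 : Vec d)‖ₑ ^ 2 ∂P ≤ ENNReal.ofReal ((R : ℝ) ^ 2) := by
      calc ∫⁻ x, ‖id x - (0 : Vec d)‖ₑ ^ 2 ∂P ≤ ∫⁻ _, ENNReal.ofReal ((R : ℝ) ^ 2) ∂P := by
            refine lintegral_mono_ae ?_
            filter_upwards [hP] with y hy
            rw [sub_zero, id, ← ofReal_norm, ← ENNReal.ofReal_pow (norm_nonneg _)]
            gcongr
        _ = _ := by simp
    -- The first input is noise around `0`, the true one is noise around `y ∼ P`: coupling each `y`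
    -- with `0` costs `α² R² / (2σ²)`.
    have := (KLBound.refl P).diffuse_map measurable_id (b := fun _ => (0 : Vec d)) measurable_const
      (by positivity) hD (α (τ 1)) (hσ 1 le_rfl hnN)
    rw [Measure.map_id, Measure.map_const, measure_univ, one_smul] at this
    refine this.mono (le_of_eq ?_)
    have := (hσ 1 le_rfl hnN).ne'
    simp only [Finset.Icc_eq_empty_of_lt one_lt_two, Finset.sum_empty]
    field_simp
    ring
  | succ n hn ih =>
    have hnN' : n ≤ N := n.le_succ.trans hnN
    have ih := ih hnN'
    obtain ⟨he, o, hom, hoP, hoe⟩ := ho n hn hnN'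
    have : IsProbabilityMeasure (outputLaw α σ f τ (n - 1)) :=
      isProbabilityMeasure_outputLaw τ fun j h1 h2 => hf j h1 (by omega)
    have hD : ∫⁻ x, ‖o x - f x (τ n)‖ₑ ^ 2 ∂marginal α σ P (τ n) ≤
        ENNReal.ofReal ((τ n * e) ^ 2) := by
      rw [← eLpNorm_two_le_iff _ he]
      refine le_of_eq_of_le ?_ hoe
      exact eLpNorm_sub_comm o (fun x => f x (τ n)) 2 _
    -- Since `o` pushes `P_{τ_n}` to `P`, the true marginal at `τ_{n+1}` is the noising of `o`'s
    -- image and the sampler's input the noising of `f`'s image.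
    have key := ih.diffuse_map hom (hf n hn hnN') (by positivity) hD (α (τ (n + 1)))
      (hσ (n + 1) (by omega) hnN)
    rw [hoP] at key
    have hout : outputLaw α σ f τ (n + 1 - 1) =
        (diffuse (α (τ n)) (σ (τ n)) (outputLaw α σ f τ (n - 1))).map fun x => f x (τ n) := by
      obtain ⟨m, rfl⟩ : ∃ m, n = m + 1 := ⟨n - 1, by omega⟩
      rfl
    rw [hout]
    refine key.mono (le_of_eq ?_)
    have := (hσ (n + 1) (by omega) hnN).ne'
    rw [Finset.sum_Icc_succ_top (by omega), Nat.add_sub_cancel]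
    generalize ∑ j ∈ Finset.Icc 2 n,
      α (τ j) ^ 2 / (4 * σ (τ j) ^ 2) * τ (j - 1) ^ 2 * e ^ 2 = S
    field_simp
    ring

/-- Replacing the law of the input of the last step by the true marginal law. -/
theorem W2_map_le {A B : Measure (Vec d)} [IsProbabilityMeasure A] [IsProbabilityMeasure B]
    {S c r : ℝ} (hr : 0 ≤ r) (hS : 0 ≤ S) (hKL : KLBound A B (2 * S)) {f o : Vec d → Vec d}
    (hf : Measurable f)
    (ho : Measurable o) (hfr : ∀ x, ‖f x‖ ≤ r)
    (hc : eLpNorm (fun x => f x - o x) 2 A ≤ ENNReal.ofReal c) (hc0 : 0 ≤ c) :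
    W2 (B.map f) (A.map o) ≤ ENNReal.ofReal (2 * r * S ^ (1 / 4 : ℝ) + c) := by
  -- Pinsker with entropy bound `2S` gives total variation at most `√S`.
  obtain ⟨m, ρ, hπA, hπB, hρ⟩ := exists_maximal_coupling (A := A) (B := B) (δ := √S) fun s hs => by
    have := hKL.measureReal_sub_le hs
    rwa [mul_div_cancel_left₀ _ two_ne_zero] at this
  set π := m.map (fun x => (x, x)) + ρ with hπ
  have hFm : Measurable fun p : Vec d × Vec d => (f p.2, o p.1) :=
    (hf.comp measurable_snd).prodMk (ho.comp measurable_fst)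
  have hmem : π.map (fun p => (f p.2, o p.1)) ∈ {γ : Measure (Vec d × Vec d) |
      γ.map Prod.fst = B.map f ∧ γ.map Prod.snd = A.map o} := by
    refine ⟨?_, ?_⟩
    · rw [Measure.map_map measurable_fst hFm, ← hπB, Measure.map_map hf measurable_snd]
      rfl
    · rw [Measure.map_map measurable_snd hFm, ← hπA, Measure.map_map ho measurable_fst]
      rfl
  refine (iInf₂_le _ hmem).trans ?_
  have hd : Measurable fun p : Vec d × Vec d => ‖p.1 - p.2‖ₑ ^ 2 := by fun_prop
  rw [lintegral_map hd hFm]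
  change (∫⁻ p, ‖f p.2 - o p.1‖ₑ ^ 2 ∂π) ^ (1 / 2 : ℝ) ≤ _
  rw [lintegral_rpow_half_eq_eLpNorm (fun p : Vec d × Vec d => f p.2 - o p.1)]
  -- The integrand vanishes on the diagonal part; off it, mass `√S` times `(2r)²` has square root
  -- `2r S^{1/4}`.
  have h1 : eLpNorm (fun p => f p.2 - f p.1) 2 π ≤ ENNReal.ofReal (2 * r * S ^ (1 / 4 : ℝ)) := by
    rw [eLpNorm_two_le_iff _ (by positivity), hπ, lintegral_add_measure,
      lintegral_map (by fun_prop) (by fun_prop)]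
    simp only [sub_self, enorm_zero, ne_eq, OfNat.ofNat_ne_zero, not_false_eq_true, zero_pow,
      lintegral_zero, zero_add]
    have hS4 : (S ^ (1 / 4 : ℝ)) ^ 2 = √S := by
      rw [← Real.rpow_natCast, ← Real.rpow_mul hS, Real.sqrt_eq_rpow]
      norm_num
    calc ∫⁻ p, ‖f p.2 - f p.1‖ₑ ^ 2 ∂ρ ≤ ∫⁻ _, ENNReal.ofReal ((2 * r) ^ 2) ∂ρ := by
          refine lintegral_mono fun p => ?_
          rw [← ofReal_norm, ← ENNReal.ofReal_pow (norm_nonneg _)]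
          gcongr
          exact (norm_sub_le _ _).trans (by linarith [hfr p.1, hfr p.2])
      _ ≤ ENNReal.ofReal ((2 * r) ^ 2) * ENNReal.ofReal √S := by
          rw [lintegral_const]
          gcongr
      _ = ENNReal.ofReal ((2 * r * S ^ (1 / 4 : ℝ)) ^ 2) := by
          rw [← ENNReal.ofReal_mul (by positivity), mul_pow _ (S ^ _), hS4]
  have h2 : eLpNorm (fun p : Vec d × Vec d => f p.1 - o p.1) 2 π ≤ ENNReal.ofReal c := by
    refine le_of_eq_of_le ?_ hc
    rw [← hπA, eLpNorm_map_measure (g := fun x => f x - o x) (hf.sub ho).aestronglyMeasurable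
      measurable_fst.aemeasurable]
    rfl
  rw [ENNReal.ofReal_add (by positivity) hc0]
  have hsplit : (fun p : Vec d × Vec d => f p.2 - o p.1) =
      (fun p => f p.2 - f p.1) + fun p => f p.1 - o p.1 := by
    ext1 p
    simp
  rw [hsplit]
  refine (eLpNorm_add_le ?_ ?_ (by norm_num)).trans (add_le_add h1 h2)
  · exact Measurable.aestronglyMeasurable (by fun_prop)
  · exact Measurable.aestronglyMeasurable (by fun_prop)

end ConsistencyError

end ConsistencyModel

end

/-! ### Assembly of the bound. -/

theorem mainTheorem1 {d : ℕ}
    -- time horizon, forward SDE, noise schedule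
    (T : ℝ) (h g α σ : ℝ → ℝ)
    (hsched : ConsistencyModel.IsNoiseSchedule T h g α σ)
    -- training partition `0, Δ, 2Δ, …, MΔ = T`
    (M : ℕ) (hM : 1 ≤ M) (Δ : ℝ) (hΔ : 0 < Δ) (hT : T = M * Δ)
    -- data distribution and consistency function estimate
    (Pdata : Measure (ConsistencyModel.Vec d)) [IsProbabilityMeasure Pdata]
    (f : ConsistencyModel.Vec d → ℝ → ConsistencyModel.Vec d)
    (hf_meas : ∀ t ∈ Set.Ioc 0 T, Measurable (fun x => f x t))
    (hf_zero : ∀ x, f x 0 = x)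
    (ε : ℝ) (hε : 0 < ε)
    (hloss : ∀ i < M,
      ConsistencyModel.consistencyLoss h g α σ Pdata T Δ f i ≤ ENNReal.ofReal (ε ^ 2))
    -- boundedness
    (R : ℝ) (hR : 0 < R)
    (hsupp : ∀ x ∈ Pdata.support, ‖x‖ ≤ R)
    (hf_bdd : ∀ x, ∀ t ∈ Set.Ioc 0 T, ‖f x t‖ ≤ R)
    -- sampling time schedule `T = τ 1 > τ 2 > … > τ N > 0` in the training partition
    (N : ℕ) (hN : 1 ≤ N) (τ : ℕ → ℝ) (hτ_one : τ 1 = T)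
    (hτ_anti : ∀ j, 1 ≤ j → j < N → τ (j + 1) < τ j)
    (hτ_mem : ∀ j, 1 ≤ j → j ≤ N → ∃ k : ℕ, 1 ≤ k ∧ k ≤ M ∧ τ j = k * Δ) :
    ConsistencyModel.W2 (ConsistencyModel.outputLaw α σ f τ N) Pdata ≤
      ENNReal.ofReal
        (2 * R * (α (τ 1) ^ 2 / (4 * σ (τ 1) ^ 2) * R ^ 2 +
            ∑ j ∈ Finset.Icc 2 N,
              α (τ j) ^ 2 / (4 * σ (τ j) ^ 2) * τ (j - 1) ^ 2 * (ε ^ 2 / Δ ^ 2)) ^ (1 / 4 : ℝ) +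
          τ N * (ε / Δ)) := by
  lift R to NNReal using hR.le
  have hP : ∀ᵐ y ∂Pdata, ‖y‖ ≤ R := by
    filter_upwards [Pdata.support_mem_ae] with y hy using hsupp y hy
  have hmem : ∀ j, 1 ≤ j → j ≤ N → τ j ∈ Set.Ioc 0 T := fun j h1 h2 => by
    obtain ⟨k, hk1, hkM, hk⟩ := hτ_mem j h1 h2
    have hk1' : (1 : ℝ) ≤ k := by exact_mod_cast hk1
    have hkM' : (k : ℝ) ≤ M := by exact_mod_cast hkM
    rw [hk, hT]
    exact ⟨by positivity, by gcongr⟩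
  have hden : ∀ j, 1 ≤ j → j ≤ N → 0 ≤ τ j * (ε / Δ) ∧
      ∃ o : ConsistencyModel.Vec d → ConsistencyModel.Vec d, Measurable o ∧
        (ConsistencyModel.marginal α σ Pdata (τ j)).map o = Pdata ∧
        eLpNorm (fun x => f x (τ j) - o x) 2 (ConsistencyModel.marginal α σ Pdata (τ j)) ≤
          ENNReal.ofReal (τ j * (ε / Δ)) := fun j h1 h2 => by
    have hpos := (hmem j h1 h2).1
    refine ⟨by positivity, ?_⟩
    obtain ⟨k, hk1, hkM, hk⟩ := hτ_mem j h1 h2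
    -- The number of training steps below `τ j` is `τ j / Δ`, so the error rate per unit time is `e
    -- = ε / Δ`.
    have hkε : τ j * (ε / Δ) = k * ε := by
      rw [hk]
      field_simp
    rw [hkε, hk]
    exact ConsistencyModel.exists_denoiser hsched hΔ hT hP hf_meas hf_zero hε hloss hk1 hkM
  have hσ : ∀ j, 1 ≤ j → j ≤ N → 0 < σ (τ j) := fun j h1 h2 => hsched.σ_pos _ (hmem j h1 h2)
  have hf : ∀ j, 1 ≤ j → j ≤ N → Measurable fun x => f x (τ j) := fun j h1 h2 =>
    hf_meas _ (hmem j h1 h2)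
  have hKL := ConsistencyModel.klBound_diffuse_outputLaw hP hσ hf hden hN le_rfl
  obtain ⟨he, o, hom, hoP, hoe⟩ := hden N hN le_rfl
  have : IsProbabilityMeasure (ConsistencyModel.outputLaw α σ f τ (N - 1)) :=
    ConsistencyModel.isProbabilityMeasure_outputLaw τ fun j h1 h2 => hf j h1 (by omega)
  have hW := ConsistencyModel.W2_map_le R.2 (by positivity) hKL (hf N hN le_rfl) hom
    (fun x => hf_bdd x _ (hmem N hN le_rfl)) hoe he
  have hout : ConsistencyModel.outputLaw α σ f τ N =
      (ConsistencyModel.diffuse (α (τ N)) (σ (τ N))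
        (ConsistencyModel.outputLaw α σ f τ (N - 1))).map fun x => f x (τ N) := by
    obtain ⟨n, rfl⟩ : ∃ n, N = n + 1 := ⟨N - 1, by omega⟩
    rfl
  rw [hoP, ← hout] at hW
  simpa only [div_pow] using! hW
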